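/- For a category $X$ let $\mathbf{Fib}_X$ be the 2-category whose 0-cells are the fibred categories over $X$ (categories $E$ with a Grothendieck fibration $q\colon E\to X$), whose 1-cells are the fibred functors over $X$ (functors that commute strictly with the projections to $X$ and send cartesian arrows to cartesian arrows), and whose 2-cells are the fibred natural transformations (natural transformations whose components lie over identities of $X$). The total categories of fibred categories have their hom-sets in a fixed universe $\mathcal V$ and their sets of objects in a fixed universe $\mathcal U\supseteq\mathcal V$, where the category $A$ below is $\mathcal V$-small. Let $p\colon A\to B$ be a Grothendieck fibration, and let the oplax sum $\Sigma_p\colon \mathbf{Fib}_A\to\mathbf{Fib}_B$ be the 2-functor given by postcomposition with $p$: it sends $q\colon E\to A$ to $p\circ q\colon E\to B$ and leaves the underlying functors and natural transformations unchanged. Then $\Sigma_p$ has a right pseudo-adjoint. That is, there are a pseudofunctor $R\colon\mathbf{Fib}_B\to\mathbf{Fib}_A$ and, for all $E\in\mathbf{Fib}_A$ and $F\in\mathbf{Fib}_B$, equivalences of categories $$\sharp_{E,F}\colon \mathbf{Fib}_A(E,R F)\;\simeq\;\mathbf{Fib}_B(\Sigma_p E,F)$$ together with invertible cells $$\sharp_{f,g}(h)\colon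 \sharp_{E',F'}(R g\circ h\circ f)\;\cong\; g\circ\sharp_{E,F}(h)\circ\Sigma_p f$$ for $f\colon E'\to E$, $g\colon F\to F'$ and $h\colon E\to R F$, which make $\sharp$ pseudo-natural in $E$ and $F$: they are natural in $h$, compatible with 2-cells in $f$ and $g$, and coherent with respect to identities and composition of the 1-cells $f$ and $g$. -/

import Mathlib

open CategoryTheory Bicategory

universe w₂ w₁ v u v₄ u₄ v₃ u₃ v₂ u₂ v₁ u₁

/-! ## The 2-category of fibred categories over a base -/

set_option linter.checkUnivs false in
/-- A fibred category over `𝒮`: a category with a projection functor to `𝒮` that is a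
(Grothendieck) fibration. -/
structure FibredCategory (𝒮 : Type u₁) [Category.{v₁} 𝒮] extends
    BasedCategory.{v₂, u₂} 𝒮 where
  isFibered : p.IsFibered

instance FibredCategory.instIsFibered {𝒮 : Type u₁} [Category.{v₁} 𝒮]
    (E : FibredCategory.{v₂, u₂} 𝒮) : E.p.IsFibered := E.isFibered

/-- A fibred functor over `𝒮`: a functor which commutes strictly with the projections to `𝒮` and
sends cartesian arrows to cartesian arrows. -/
structure FibredFunctor {𝒮 : Type u₁} [Category.{v₁} 𝒮] (E : FibredCategory.{v₂, u₂} 𝒮)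
    (F : FibredCategory.{v₃, u₃} 𝒮) extends
    BasedFunctor E.toBasedCategory F.toBasedCategory where
  map_cartesian : ∀ {a b : 𝒮} (f : a ⟶ b) {x y : E.obj} (φ : x ⟶ y),
    E.p.IsStronglyCartesian f φ → F.p.IsStronglyCartesian f (toFunctor.map φ)

namespace FibredFunctor

variable {𝒮 : Type u₁} [Category.{v₁} 𝒮]

/-- The identity fibred functor. -/
def id (E : FibredCategory.{v₂, u₂} 𝒮) : FibredFunctor E E where
  toBasedFunctor := BasedFunctor.id E.toBasedCategory
  map_cartesian _ _ _ _ h := h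

/-- Composition of fibred functors. -/
def comp {E : FibredCategory.{v₂, u₂} 𝒮} {F : FibredCategory.{v₃, u₃} 𝒮}
    {G : FibredCategory.{v₄, u₄} 𝒮} (S : FibredFunctor E F) (T : FibredFunctor F G) :
    FibredFunctor E G where
  toBasedFunctor := BasedFunctor.comp S.toBasedFunctor T.toBasedFunctor
  map_cartesian f _ _ φ h := T.map_cartesian f (S.toFunctor.map φ) (S.map_cartesian f φ h)

/-- The category of fibred functors `E ⟶ F` over `𝒮`. Its arrows are the fibred natural
transformations, i.e. the natural transformations all of whose components are vertical. -/
instance homCategory (E : FibredCategory.{v₂, u₂} 𝒮) (F : FibredCategory.{v₃, u₃} 𝒮) :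
    Category (FibredFunctor E F) where
  Hom S T := BasedNatTrans S.toBasedFunctor T.toBasedFunctor
  id S := BasedNatTrans.id S.toBasedFunctor
  comp α β := BasedNatTrans.comp α β

@[ext]
theorem hom_ext {E : FibredCategory.{v₂, u₂} 𝒮} {F : FibredCategory.{v₃, u₃} 𝒮}
    {S T : FibredFunctor E F} (α β : S ⟶ T)
    (h : ∀ x, α.toNatTrans.app x = β.toNatTrans.app x) : α = β :=
  BasedNatTrans.ext α β (NatTrans.ext (funext h))

end FibredFunctor

namespace FibredCategory

variable {𝒮 : Type u₁} [Category.{v₁} 𝒮]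

instance : CategoryStruct (FibredCategory.{v₂, u₂} 𝒮) where
  Hom E F := FibredFunctor E F
  id E := FibredFunctor.id E
  comp S T := FibredFunctor.comp S T

/-- The 2-category `FIB 𝒮` of fibred categories over `𝒮`, fibred functors over `𝒮`, and fibred
natural transformations. Composition of 1-cells is strictly associative and unital, so the
associators and unitors are identities. -/
instance bicategory : Bicategory (FibredCategory.{v₂, u₂} 𝒮) where
  homCategory E F := FibredFunctor.homCategory E F
  whiskerLeft S _ _ α := BasedCategory.whiskerLeft S.toBasedFunctor α
  whiskerRight α T := BasedCategory.whiskerRight α T.toBasedFunctor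
  associator {E _ _ G} S T U :=
    Iso.refl (C := FibredFunctor E G) (FibredFunctor.comp S (FibredFunctor.comp T U))
  leftUnitor {E F} S := Iso.refl (C := FibredFunctor E F) S
  rightUnitor {E F} S := Iso.refl (C := FibredFunctor E F) S
  whiskerLeft_id _ _ := rfl
  whiskerLeft_comp _ _ _ _ _ _ := rfl
  id_whiskerLeft _ := by
    refine BasedNatTrans.ext _ _ (NatTrans.ext (funext fun _ => ?_))
    exact ((Category.id_comp _).trans (Category.comp_id _)).symm
  comp_whiskerLeft _ _ _ _ _ := by
    refine BasedNatTrans.ext _ _ (NatTrans.ext (funext fun _ => ?_))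
    exact ((Category.id_comp _).trans (Category.comp_id _)).symm
  id_whiskerRight S T := by
    refine BasedNatTrans.ext _ _ (NatTrans.ext (funext fun _ => ?_))
    exact T.toFunctor.map_id _
  comp_whiskerRight _ _ T := by
    refine BasedNatTrans.ext _ _ (NatTrans.ext (funext fun _ => ?_))
    exact T.toFunctor.map_comp _ _
  whiskerRight_id _ := by
    refine BasedNatTrans.ext _ _ (NatTrans.ext (funext fun _ => ?_))
    exact ((Category.id_comp _).trans (Category.comp_id _)).symm
  whiskerRight_comp _ _ _ := by
    refine BasedNatTrans.ext _ _ (NatTrans.ext (funext fun _ => ?_))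
    exact ((Category.id_comp _).trans (Category.comp_id _)).symm
  whisker_assoc _ _ _ _ _ := by
    refine BasedNatTrans.ext _ _ (NatTrans.ext (funext fun _ => ?_))
    exact ((Category.id_comp _).trans (Category.comp_id _)).symm
  whisker_exchange η θ := by
    refine BasedNatTrans.ext _ _ (NatTrans.ext (funext fun _ => ?_))
    exact (θ.toNatTrans.naturality _).symm
  pentagon S T U V := by
    refine BasedNatTrans.ext _ _ (NatTrans.ext (funext fun _ => ?_))
    change (V.toFunctor.map (𝟙 _) ≫ 𝟙 _ ≫ 𝟙 _) = 𝟙 _ ≫ 𝟙 _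
    simp
  triangle S T := by
    refine BasedNatTrans.ext _ _ (NatTrans.ext (funext fun _ => ?_))
    change (𝟙 _ ≫ 𝟙 _) = T.toFunctor.map (𝟙 _)
    simp

instance : Bicategory.Strict (FibredCategory.{v₂, u₂} 𝒮) where
  id_comp _ := rfl
  comp_id _ := rfl
  assoc _ _ _ := rfl
  leftUnitor_eqToIso _ := rfl
  rightUnitor_eqToIso _ := rfl
  associator_eqToIso _ _ _ := rfl

theorem hom₂_ext {E F : FibredCategory.{v₂, u₂} 𝒮} {S T : E ⟶ F} (α β : S ⟶ T)
    (h : ∀ x, α.toNatTrans.app x = β.toNatTrans.app x) : α = β :=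
  FibredFunctor.hom_ext (E := E) (F := F) α β h

end FibredCategory


/-! ## The oplax sum along a fibration -/

section Composite

open Functor

variable {A : Type u₁} [Category.{v₁} A] {B : Type u₂} [Category.{v₂} B]
  {X : Type u₃} [Category.{v₃} X]

/-- An arrow lying over `f` for a composite functor has its image lying over `f`. -/
theorem isHomLift_of_comp (q : X ⥤ A) (p : A ⥤ B) {r s : B} {x y : X} (f : r ⟶ s) (φ : x ⟶ y)
    (h : (q ⋙ p).IsHomLift f φ) : p.IsHomLift f (q.map φ) := by
  obtain ⟨⟩ := h
  exact IsHomLift.map p (q.map φ)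

/-- An arrow lying over `g` lies over `p.map g` for the composite with `p`. -/
theorem isHomLift_comp (q : X ⥤ A) (p : A ⥤ B) {a b : A} {x y : X} (g : a ⟶ b) (φ : x ⟶ y)
    (h : q.IsHomLift g φ) : (q ⋙ p).IsHomLift (p.map g) φ := by
  obtain ⟨⟩ := h
  exact IsHomLift.map (q ⋙ p) φ

/-- A `q`-cartesian lift of a `p`-cartesian arrow is `(q ⋙ p)`-cartesian. -/
theorem isStronglyCartesian_comp (q : X ⥤ A) (p : A ⥤ B) {a b : A} {r s : B} {x y : X}
    (f : r ⟶ s) (g : a ⟶ b) (φ : x ⟶ y) (hg : p.IsStronglyCartesian f g)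
    (hφ : q.IsStronglyCartesian g φ) : (q ⋙ p).IsStronglyCartesian f φ := by
  obtain ⟨⟩ := hφ.toIsHomLift
  obtain ⟨⟩ := hg.toIsHomLift
  refine { toIsHomLift := IsHomLift.map (q ⋙ p) φ, universal_property' := ?_ }
  intro z h ψ hψ
  have hψ' : p.IsHomLift (h ≫ p.map (q.map φ)) (q.map ψ) := by
    have := IsHomLift.eq_of_isHomLift (q ⋙ p) (h ≫ (p.map (q.map φ))) ψ
    rw [this]; exact IsHomLift.map p (q.map ψ)
  obtain ⟨k, ⟨hk, hk'⟩, hku⟩ := hg.universal_property' (a' := q.obj z) h (q.map ψ)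
  have hψ'' : q.IsHomLift (k ≫ q.map φ) ψ := by rw [hk']; exact IsHomLift.map q ψ
  obtain ⟨χ, ⟨hχ, hχ'⟩, hχu⟩ := hφ.universal_property' k ψ
  have e : k = q.map χ := IsHomLift.eq_of_isHomLift q k χ
  have e' : h = p.map k := IsHomLift.eq_of_isHomLift p h k
  refine ⟨χ, ⟨?_, hχ'⟩, ?_⟩
  · rw [e', e]; exact IsHomLift.map (q ⋙ p) χ
  · rintro χ' ⟨h1, h2⟩
    have e1 : h = p.map (q.map χ') := IsHomLift.eq_of_isHomLift (q ⋙ p) h χ'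
    have e2 : q.map χ' = k := by
      refine hku _ ⟨?_, ?_⟩
      · rw [e1]; exact IsHomLift.map p _
      · rw [← q.map_comp, h2]
    refine hχu _ ⟨?_, h2⟩
    rw [← e2]; exact IsHomLift.map q χ'

/-- Cartesian lifts for the composite of two fibrations are computed successively. -/
theorem exists_isStronglyCartesian_comp (q : X ⥤ A) (p : A ⥤ B) [q.IsFibered] [p.IsFibered]
    {r : B} (y : X) (f : r ⟶ p.obj (q.obj y)) :
    ∃ (a : A) (g : a ⟶ q.obj y) (x : X) (φ : x ⟶ y),
      p.IsStronglyCartesian f g ∧ q.IsStronglyCartesian g φ := by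
  obtain ⟨a, g, hg⟩ := IsPreFibered.exists_isCartesian' (p := p) f
  obtain ⟨x, φ, hφ⟩ := IsPreFibered.exists_isCartesian' (p := q) g
  exact ⟨a, g, x, φ, inferInstance, inferInstance⟩

/-- The composite of two fibrations is a fibration. -/
theorem isFibered_comp (q : X ⥤ A) (p : A ⥤ B) [q.IsFibered] [p.IsFibered] :
    (q ⋙ p).IsFibered := by
  refine IsFibered.of_exists_isStronglyCartesian fun y r f => ?_
  obtain ⟨a, g, x, φ, hg, hφ⟩ := exists_isStronglyCartesian_comp q p y f
  exact ⟨x, φ, isStronglyCartesian_comp q p f g φ hg hφ⟩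

/-- An arrow that is cartesian for a composite of fibrations is cartesian for the first of them,
over an arrow that is cartesian for the second. -/
theorem isStronglyCartesian_of_comp (q : X ⥤ A) (p : A ⥤ B) [q.IsFibered] [p.IsFibered]
    {r s : B} {x y : X} (f : r ⟶ s) (φ : x ⟶ y) (h : (q ⋙ p).IsStronglyCartesian f φ) :
    p.IsStronglyCartesian f (q.map φ) ∧ q.IsStronglyCartesian (q.map φ) φ := by
  have hl := h.toIsHomLift
  obtain ⟨⟩ := hl
  obtain ⟨a, g, x', φ', hg, hφ'⟩ := exists_isStronglyCartesian_comp q p y ((q ⋙ p).map φ)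
  have h' := isStronglyCartesian_comp q p _ g φ' hg hφ'
  let i := IsCartesian.domainUniqueUpToIso (q ⋙ p) ((q ⋙ p).map φ) φ' φ
  have hi : i.hom ≫ φ' = φ := IsCartesian.fac (q ⋙ p) ((q ⋙ p).map φ) φ' φ
  have hg' : g = eqToHom (IsHomLift.domain_eq q g φ').symm ≫ q.map φ' := by
    simpa using IsHomLift.fac q g φ'
  obtain rfl : q.obj x' = a := IsHomLift.domain_eq q g φ'
  obtain rfl : g = q.map φ' := by simpa using hg'
  have hi1 : (q ⋙ p).IsHomLift (𝟙 _) i.hom := 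
    IsCartesian.map_isHomLift (q ⋙ p) ((q ⋙ p).map φ) φ' φ
  have hi2 : p.IsHomLift (𝟙 ((q ⋙ p).obj x)) (q.map i.hom) :=
    isHomLift_of_comp q p _ _ hi1
  constructor
  · have : p.IsStronglyCartesian (𝟙 ((q ⋙ p).obj x)) (q.map i.hom) := inferInstance
    have := IsStronglyCartesian.comp (p := p) (f := 𝟙 ((q ⋙ p).obj x)) (g := (q ⋙ p).map φ)
      (φ := q.map i.hom) (ψ := q.map φ')
    rwa [Category.id_comp, ← q.map_comp, hi] at this
  · have : q.IsStronglyCartesian (q.map i.hom) i.hom := inferInstance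
    have := IsStronglyCartesian.comp (p := q) (f := q.map i.hom) (g := q.map φ')
      (φ := i.hom) (ψ := φ')
    rwa [← q.map_comp, hi] at this

end Composite

section OplaxSum

variable {A : Type u₁} [Category.{v₁} A] {B : Type u₂} [Category.{v₂} B]

/-- The oplax sum of a fibred category `E` over `A` along a fibration `p : A ⥤ B`: it has the same
total category as `E`, and its projection is the composite of the projection of `E` with `p`. -/
def oplaxSumObj (p : A ⥤ B) [p.IsFibered] (E : FibredCategory.{v₃, u₃} A) :
    FibredCategory.{v₃, u₃} B where
  toBasedCategory := BasedCategory.ofFunctor (E.p ⋙ p)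
  isFibered := isFibered_comp E.p p

/-- The action of the oplax sum on fibred functors: the underlying functor is unchanged. -/
def oplaxSumMap (p : A ⥤ B) [p.IsFibered] {E F : FibredCategory.{v₃, u₃} A} (S : E ⟶ F) :
    oplaxSumObj p E ⟶ oplaxSumObj p F where
  toFunctor := S.toFunctor
  w := congrArg (· ⋙ p) S.w
  map_cartesian f x y φ h := by
    obtain ⟨h₁, h₂⟩ := isStronglyCartesian_of_comp E.p p f φ h
    exact isStronglyCartesian_comp F.p p f _ _ h₁ (S.map_cartesian _ φ h₂)

/-- The action of the oplax sum on fibred natural transformations: the components are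
unchanged. -/
def oplaxSumMap₂ (p : A ⥤ B) [p.IsFibered] {E F : FibredCategory.{v₃, u₃} A} {S T : E ⟶ F}
    (α : S ⟶ T) : oplaxSumMap p S ⟶ oplaxSumMap p T where
  toNatTrans := α.toNatTrans
  isHomLift' x := by
    obtain h : F.p.IsHomLift (𝟙 (E.p.obj x)) (α.toNatTrans.app x) := α.isHomLift' x
    have h' := isHomLift_comp F.p p _ _ h
    rwa [p.map_id] at h'

/-- The oplax sum `2`-functor `FIB A → FIB B` along a fibration `p : A ⥤ B`, given by
postcomposition with `p`. -/
def oplaxSum (p : A ⥤ B) [p.IsFibered] :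
    StrictPseudofunctor (FibredCategory.{v₃, u₃} A) (FibredCategory.{v₃, u₃} B) where
  obj := oplaxSumObj p
  map := oplaxSumMap p
  map₂ := oplaxSumMap₂ p
  mapId _ := Iso.refl _
  mapComp _ _ := Iso.refl _
  mapId_eq_eqToIso _ := rfl
  mapComp_eq_eqToIso _ _ := rfl
  map₂_whisker_left _ _ _ _ := FibredCategory.hom₂_ext _ _ fun _ => ((Category.id_comp _).trans (Category.comp_id _)).symm
  map₂_whisker_right _ _ := FibredCategory.hom₂_ext _ _ fun _ => ((Category.id_comp _).trans (Category.comp_id _)).symm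
  map₂_associator _ _ U := FibredCategory.hom₂_ext _ _ fun _ => by
    change 𝟙 _ = 𝟙 _ ≫ U.toFunctor.map (𝟙 _) ≫ 𝟙 _ ≫ 𝟙 _ ≫ 𝟙 _
    simp
  map₂_left_unitor S := FibredCategory.hom₂_ext _ _ fun _ => by
    change 𝟙 _ = 𝟙 _ ≫ S.toFunctor.map (𝟙 _) ≫ 𝟙 _
    rw [Category.id_comp, Category.comp_id]
    exact (S.toFunctor.map_id _).symm
  map₂_right_unitor S := FibredCategory.hom₂_ext _ _ fun _ => by
    change 𝟙 _ = 𝟙 _ ≫ 𝟙 _ ≫ 𝟙 _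
    simp

end OplaxSum

/-! ## Pseudo-adjunctions -/

section PseudoAdjunction

variable {𝒞 : Type u₁} [Bicategory.{w₁, v₁} 𝒞] {𝒟 : Type u₂} [Bicategory.{w₂, v₂} 𝒟]

/-- The canonical reassociation of a composite of five 1-cells in a bicategory. -/
def reassocIso {a b c d e z : 𝒞} (f' : a ⟶ b) (f : b ⟶ c) (h : c ⟶ d) (k : d ⟶ e) (k' : e ⟶ z) :
    (f' ≫ f) ≫ h ≫ k ≫ k' ≅ f' ≫ (f ≫ h ≫ k) ≫ k' :=
  α_ f' f (h ≫ k ≫ k') ≪≫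
    whiskerLeftIso f' (whiskerLeftIso f (α_ h k k').symm ≪≫ (α_ f (h ≫ k) k').symm)

/-- A pseudo-adjunction `L ⊣ R` between pseudofunctors `L : 𝒞 → 𝒟` and `R : 𝒟 → 𝒞` of
bicategories: an equivalence of hom-categories `𝒞(X, R Y) ≃ 𝒟(L X, Y)` that is pseudo-natural
in `X` and `Y`. -/
structure PseudoAdjunction (L : 𝒞 ⥤ᵖ 𝒟) (R : 𝒟 ⥤ᵖ 𝒞) where
  /-- the transposition functors -/
  transpose (X : 𝒞) (Y : 𝒟) : (X ⟶ R.obj Y) ⥤ (L.obj X ⟶ Y)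
  isEquivalence (X : 𝒞) (Y : 𝒟) : (transpose X Y).IsEquivalence
  /-- the invertible pseudo-naturality cells -/
  cell {X X' : 𝒞} {Y Y' : 𝒟} (f : X' ⟶ X) (g : Y ⟶ Y') (h : X ⟶ R.obj Y) :
    (transpose X' Y').obj (f ≫ h ≫ R.map g) ≅ L.map f ≫ (transpose X Y).obj h ≫ g
  /-- each pseudo-naturality cell is a natural transformation between functors
  `𝒞(X, R Y) ⥤ 𝒟(L X', Y')` -/
  cell_natural {X X' : 𝒞} {Y Y' : 𝒟} (f : X' ⟶ X) (g : Y ⟶ Y') {h h' : X ⟶ R.obj Y}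
    (θ : h ⟶ h') :
    (transpose X' Y').map (f ◁ θ ▷ R.map g) ≫ (cell f g h').hom =
      (cell f g h).hom ≫ L.map f ◁ (transpose X Y).map θ ▷ g
  /-- compatibility of the pseudo-naturality cells with 2-cells -/
  cell_map₂ {X X' : 𝒞} {Y Y' : 𝒟} {f f' : X' ⟶ X} {g g' : Y ⟶ Y'} (σ : f ⟶ f') (τ : g ⟶ g')
    (h : X ⟶ R.obj Y) :
    (transpose X' Y').map (σ ▷ (h ≫ R.map g) ≫ f' ◁ h ◁ R.map₂ τ) ≫ (cell f' g' h).hom =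
      (cell f g h).hom ≫
        L.map₂ σ ▷ ((transpose X Y).obj h ≫ g) ≫ L.map f' ◁ (transpose X Y).obj h ◁ τ
  /-- compatibility of the pseudo-naturality cells with identity 1-cells -/
  cell_id {X : 𝒞} {Y : 𝒟} (h : X ⟶ R.obj Y) :
    (cell (𝟙 X) (𝟙 Y) h).hom ≫ (L.mapId X).hom ▷ ((transpose X Y).obj h ≫ 𝟙 Y) ≫
        (λ_ ((transpose X Y).obj h ≫ 𝟙 Y)).hom ≫ (ρ_ ((transpose X Y).obj h)).hom =
      (transpose X Y).map (𝟙 X ◁ h ◁ (R.mapId Y).hom ≫ (λ_ (h ≫ 𝟙 (R.obj Y))).hom ≫ (ρ_ h).hom)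
  /-- compatibility of the pseudo-naturality cells with composition of 1-cells -/
  cell_comp {X X' X'' : 𝒞} {Y Y' Y'' : 𝒟} (f : X' ⟶ X) (f' : X'' ⟶ X') (g : Y ⟶ Y')
    (g' : Y' ⟶ Y'') (h : X ⟶ R.obj Y) :
    (cell (f' ≫ f) (g ≫ g') h).hom ≫
        (L.mapComp f' f).hom ▷ ((transpose X Y).obj h ≫ g ≫ g') ≫
          (reassocIso (L.map f') (L.map f) ((transpose X Y).obj h) g g').hom =
      (transpose X'' Y'').map
          ((f' ≫ f) ◁ h ◁ (R.mapComp g g').hom ≫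
            (reassocIso f' f h (R.map g) (R.map g')).hom) ≫
        (cell f' g' (f ≫ h ≫ R.map g)).hom ≫ L.map f' ◁ (cell f g h).hom ▷ g'

end PseudoAdjunction

/-!
The right adjoint `R` is found by the fibrational Yoneda lemma: the fibre of `R F` over `a : A`
has to be the category of fibred functors over `A` from the slice `A / a` to `R F`, that is, the
category of fibred functors over `B` from the oplax sum of `A / a` to `F`. The total category with
these fibres is `OplaxSumRight p F`. Restriction along the arrows of `A` provides the cartesian
arrows (`reindexHom`), and an arrow is cartesian precisely when its components at identities are
invertible (`isStronglyCartesian_of_isIso_app`, `isIso_app_of_isStronglyCartesian`).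
Postcomposition makes `R` a strict pseudofunctor (`oplaxSumRight`).

Evaluation at the identity `𝟙 a`, regarded as an object of `A / a`, is a fibred functor over `B`
from the oplax sum of `R F` to `F`, the counit (`oplaxSumCounit`). Transposition applies the oplax
sum and composes with the counit. As evaluation commutes strictly with postcomposition, the
pseudo-naturality cells can be taken to be identities, and the content lies in transposition being
an equivalence.

* It is fully faithful because a cartesian arrow `e' ⟶ e` of `E` over `w` identifies the value at
  `w` of the functor `H e` with the value at the identity of `H e'`. Hence the components of a
  transformation at `w` are determined by, and can be defined from, those at identities
  (`exists_hom`).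
* It is essentially surjective because `K : Σ E ⟶ F` is isomorphic to the transpose of the fibred
  functor sending `e` to `w ↦ K (w^* e)`, where `w^* e` is a chosen cartesian lift
  (`cotranspose`).
-/

/-! ### Representable fibred categories -/

section Over

variable {A : Type u₁} [Category.{v₁} A]

theorem over_left_eq_of_isHomLift {a : A} {w w' : Over a} (f : w.left ⟶ w'.left) (m : w ⟶ w')
    (h : (Over.forget a).IsHomLift f m) : m.left = f :=
  (@IsHomLift.eq_of_isHomLift _ _ _ _ (Over.forget a) w w' f m h).symm

/-- Every arrow of a slice category is cartesian over the domain. -/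
theorem isStronglyCartesian_overForget {a : A} {w w' : Over a} (m : w ⟶ w') :
    (Over.forget a).IsStronglyCartesian m.left m where
  toIsHomLift := IsHomLift.map (Over.forget a) m
  universal_property' {z} h ψ hψ := by
    change z.left ⟶ w.left at h
    have e : ψ.left = h ≫ m.left := over_left_eq_of_isHomLift _ ψ hψ
    have hw : h ≫ w.hom = z.hom := by
      rw [← Over.w m, ← Category.assoc, ← e, Over.w ψ]
    refine ⟨Over.homMk h hw, ⟨IsHomLift.map (Over.forget a) (Over.homMk h hw), ?_⟩, ?_⟩
    · ext; exact e.symm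
    · rintro χ ⟨hχ, -⟩
      ext
      exact over_left_eq_of_isHomLift h χ hχ

instance isFibered_overForget (a : A) : (Over.forget a).IsFibered :=
  Functor.IsFibered.of_exists_isStronglyCartesian fun y r f => by
    change r ⟶ y.left at f
    exact ⟨Over.mk (f ≫ y.hom), Over.homMk f rfl,
      isStronglyCartesian_overForget (Over.homMk f rfl : Over.mk (f ≫ y.hom) ⟶ y)⟩

/-- The representable fibred category of `a : A`: the slice `A / a` with the domain functor. -/
def overFibred (a : A) : FibredCategory.{v₁, max u₁ v₁} A where
  toBasedCategory := BasedCategory.ofFunctor (Over.forget a)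
  isFibered := isFibered_overForget a

/-- The fibred functor between slices given by composition with an arrow of `A`. -/
def overFibredMap {a b : A} (g : a ⟶ b) : overFibred a ⟶ overFibred b where
  toFunctor := Over.map g
  w := rfl
  map_cartesian {_ _} f x y φ h := by
    obtain ⟨⟩ := h.toIsHomLift
    exact isStronglyCartesian_overForget ((Over.map g).map φ)

end Over

section Preservation

variable {𝒮 : Type u₁} [Category.{v₁} 𝒮]

/-- A based functor preserves all cartesian arrows as soon as it preserves the arrows of one
cleavage. -/
theorem BasedFunctor.isStronglyCartesian_map_of_cleavage {X : BasedCategory.{v₂, u₂} 𝒮}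
    {Y : BasedCategory.{v₃, u₃} 𝒮} (G : BasedFunctor X Y)
    (hG : ∀ (y : X.obj) {r : 𝒮} (f : r ⟶ X.p.obj y), ∃ (x : X.obj) (ψ : x ⟶ y),
      X.p.IsStronglyCartesian f ψ ∧ Y.p.IsStronglyCartesian f (G.map ψ))
    {a b : 𝒮} (f : a ⟶ b) {x y : X.obj} (φ : x ⟶ y) (hφ : X.p.IsStronglyCartesian f φ) :
    Y.p.IsStronglyCartesian f (G.map φ) := by
  obtain ⟨⟩ := hφ.toIsHomLift
  obtain ⟨x', ψ, h, h'⟩ := hG y (X.p.map φ)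
  let i := Functor.IsCartesian.domainUniqueUpToIso X.p (X.p.map φ) ψ φ
  have hi : i.hom ≫ ψ = φ := Functor.IsCartesian.fac X.p (X.p.map φ) ψ φ
  have : X.p.IsHomLift (𝟙 _) i.hom :=
    Functor.IsCartesian.map_isHomLift X.p (X.p.map φ) ψ φ
  have : Y.p.IsStronglyCartesian (𝟙 _) (G.map i.hom) :=
    Functor.IsStronglyCartesian.of_isIso Y.p (𝟙 (X.p.obj x)) (G.map i.hom)
  have := Functor.IsStronglyCartesian.comp (p := Y.p) (f := 𝟙 (X.p.obj x)) (g := X.p.map φ)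
    (φ := G.map i.hom) (ψ := G.map ψ)
  rwa [Category.id_comp, ← G.map_comp, hi] at this

end Preservation

/-! ### The total category of the right adjoint -/

section RightAdjoint

variable {A : Type u₁} [Category.{v₁} A] {B : Type u₂} [Category.{v₂} B]

/-- The objects of the total category of the right adjoint of the oplax sum along `p`, evaluated
at `F`: an object `a` of `A` together with a fibred functor over `B` from the oplax sum of the
slice `A / a` to `F`. -/
structure OplaxSumRight (p : A ⥤ B) [p.IsFibered] (F : FibredCategory.{v₃, u₃} B) where
  /-- the object of `A` over which the fibred functor lives -/
  base : A
  /-- the fibred functor on the slice -/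
  fibred : FibredFunctor (oplaxSumObj p (overFibred base)) F

namespace OplaxSumRight

variable {p : A ⥤ B} [p.IsFibered] {F : FibredCategory.{v₃, u₃} B}

/-- The functor on the slice category underlying an object of `OplaxSumRight p F`. -/
def functor (X : OplaxSumRight p F) : Over X.base ⥤ F.obj := X.fibred.toFunctor

theorem functor_obj (X : OplaxSumRight p F) (w : Over X.base) :
    F.p.obj (X.functor.obj w) = p.obj w.left :=
  X.fibred.w_obj w

instance isHomLift_functor_map (X : OplaxSumRight p F) {w w' : Over X.base} (m : w ⟶ w') :
    F.p.IsHomLift (p.map m.left) (X.functor.map m) := by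
  have : (oplaxSumObj p (overFibred X.base)).p.IsHomLift (p.map m.left) m :=
    IsHomLift.map (Over.forget X.base ⋙ p) m
  exact BasedFunctor.preserves_isHomLift X.fibred.toBasedFunctor (p.map m.left) m

theorem isStronglyCartesian_functor_map (X : OplaxSumRight p F) {w w' : Over X.base} (m : w ⟶ w')
    {r s : B} (f : r ⟶ s) (h : p.IsStronglyCartesian f m.left) :
    F.p.IsStronglyCartesian f (X.functor.map m) :=
  X.fibred.map_cartesian f m
    (isStronglyCartesian_comp (Over.forget X.base) p f m.left m h
      (isStronglyCartesian_overForget m))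

/-- An arrow `X ⟶ Y` of the total category lies over an arrow `base` of `A`. It amounts to a fibred
transformation from `X` to the restriction of `Y` along `base`. It is encoded by one component for
each arrow `k` over `base` between objects `w` and `w'` of the two slices, rather than only for
those with `w' = w ≫ base`, so that no transport along associativity of composition is needed. -/
structure Hom (X Y : OplaxSumRight p F) where
  /-- the underlying arrow of `A` -/
  base : X.base ⟶ Y.base
  /-- the components -/
  app {w : Over X.base} {w' : Over Y.base} (k : w.left ⟶ w'.left)
    (hk : k ≫ w'.hom = w.hom ≫ base) : X.functor.obj w ⟶ Y.functor.obj w'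
  isHomLift {w : Over X.base} {w' : Over Y.base} (k : w.left ⟶ w'.left)
    (hk : k ≫ w'.hom = w.hom ≫ base) : F.p.IsHomLift (p.map k) (app k hk)
  map_app {w₁ w : Over X.base} {w' : Over Y.base} (m : w₁ ⟶ w) (k : w.left ⟶ w'.left)
    (hk : k ≫ w'.hom = w.hom ≫ base) :
    X.functor.map m ≫ app k hk = app (w := w₁) (m.left ≫ k) (by simp [hk])
  app_map {w : Over X.base} {w' w₁' : Over Y.base} (k : w.left ⟶ w'.left)
    (hk : k ≫ w'.hom = w.hom ≫ base) (n : w' ⟶ w₁') :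
    app k hk ≫ Y.functor.map n = app (w' := w₁') (k ≫ n.left) (by simp [hk])

attribute [instance] Hom.isHomLift

namespace Hom

theorem ext {X Y : OplaxSumRight p F} {α β : Hom X Y} (hb : α.base = β.base)
    (h : ∀ {w : Over X.base} {w' : Over Y.base} (k : w.left ⟶ w'.left)
      (hk : k ≫ w'.hom = w.hom ≫ α.base), α.app k hk = β.app k (hb ▸ hk)) : α = β := by
  obtain ⟨b, a, _, _, _⟩ := α
  obtain ⟨b', a', _, _, _⟩ := β
  obtain rfl : b = b' := hb
  obtain rfl : @a = @a' := by
    funext w w' k hk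
    exact h k hk
  rfl

theorem app_congr {X Y : OplaxSumRight p F} {α β : Hom X Y} (h : α = β) {w : Over X.base}
    {w' : Over Y.base} {k k' : w.left ⟶ w'.left} (hkk : k = k')
    (hk : k ≫ w'.hom = w.hom ≫ α.base) (hk' : k' ≫ w'.hom = w.hom ≫ β.base) :
    α.app k hk = β.app k' hk' := by
  subst h hkk
  rfl

/-- The identity arrow, whose components are the values of the functor on arrows. -/
def id (X : OplaxSumRight p F) : Hom X X where
  base := 𝟙 _
  app {w w'} k hk := X.functor.map (Over.homMk k (by simpa using hk) : w ⟶ w')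
  isHomLift {w w'} k hk := X.isHomLift_functor_map (Over.homMk k (by simpa using hk) : w ⟶ w')
  map_app m k hk := by
    rw [← X.functor.map_comp]; congr 1
  app_map k hk n := by
    rw [← X.functor.map_comp]; congr 1

/-- Naturality of both families of components makes a composite insensitive to the object through
which a square is factored. -/
theorem app_comp_app_aux {X Y Z : OplaxSumRight p F} (α : Hom X Y) (β : Hom Y Z) {w : Over X.base}
    {w₁ w₂ : Over Y.base} {w' : Over Z.base} (l₁ : w.left ⟶ w₁.left)
    (hl₁ : l₁ ≫ w₁.hom = w.hom ≫ α.base) (n : w₁ ⟶ w₂) {k₁ : w₁.left ⟶ w'.left}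
    (hk₁ : k₁ ≫ w'.hom = w₁.hom ≫ β.base) {l₂ : w.left ⟶ w₂.left}
    (hl₂ : l₂ ≫ w₂.hom = w.hom ≫ α.base) (k₂ : w₂.left ⟶ w'.left)
    (hk₂ : k₂ ≫ w'.hom = w₂.hom ≫ β.base) (h₁ : n.left ≫ k₂ = k₁) (h₂ : l₁ ≫ n.left = l₂) :
    α.app l₁ hl₁ ≫ β.app k₁ hk₁ = α.app l₂ hl₂ ≫ β.app k₂ hk₂ := by
  subst h₁ h₂
  rw [← α.app_map l₁ hl₁ n, ← β.map_app n k₂ hk₂, Category.assoc]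

/-- Composition of arrows: every composite square is factored through the object obtained by
composing with the base of the first arrow. -/
def comp {X Y Z : OplaxSumRight p F} (α : Hom X Y) (β : Hom Y Z) : Hom X Z where
  base := α.base ≫ β.base
  app {w _} k hk := α.app (w' := Over.mk (w.hom ≫ α.base)) (𝟙 w.left) (Category.id_comp _) ≫
    β.app (w := Over.mk (w.hom ≫ α.base)) k (hk.trans (Category.assoc _ _ _).symm)
  isHomLift {w w'} k hk := by
    have h := @IsHomLift.comp _ _ _ _ F.p _ _ _ _ _ _ _ _ _ _
      (α.isHomLift (w' := Over.mk (w.hom ≫ α.base)) (𝟙 w.left) (Category.id_comp _))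
      (β.isHomLift (w := Over.mk (w.hom ≫ α.base)) k (hk.trans (Category.assoc _ _ _).symm))
    have e : p.map (𝟙 w.left) ≫ p.map k = p.map k := by rw [p.map_id, Category.id_comp]
    exact e ▸ h
  map_app {w₁ w w'} m k hk := by
    rw [← Category.assoc, α.map_app]
    exact (app_comp_app_aux α β _ _
      (Over.homMk m.left (by simp) : Over.mk (w₁.hom ≫ α.base) ⟶ Over.mk (w.hom ≫ α.base))
      _ _ _ _ rfl ((Category.id_comp _).trans (Category.comp_id _).symm)).symm
  app_map k hk n := by
    rw [Category.assoc, β.app_map]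

/-- A composite may be computed by factoring a square in any way. -/
theorem app_comp_app {X Y Z : OplaxSumRight p F} (α : Hom X Y) (β : Hom Y Z) {w : Over X.base}
    {w' : Over Y.base} {w'' : Over Z.base} (l : w.left ⟶ w'.left)
    (hl : l ≫ w'.hom = w.hom ≫ α.base) (k : w'.left ⟶ w''.left)
    (hk : k ≫ w''.hom = w'.hom ≫ β.base) {m : w.left ⟶ w''.left} (h : l ≫ k = m)
    (hm : m ≫ w''.hom = w.hom ≫ α.base ≫ β.base) :
    α.app l hl ≫ β.app k hk = (comp α β).app m hm :=
  (app_comp_app_aux α β _ _ (Over.homMk l hl : Over.mk (w.hom ≫ α.base) ⟶ w') _ _ _ _ h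
    (Category.id_comp _)).symm

end Hom

instance : Category (OplaxSumRight p F) where
  Hom := Hom
  id := Hom.id
  comp := Hom.comp
  id_comp {X Y} α := Hom.ext (Category.id_comp α.base) fun {w w'} k hk =>
    (α.map_app (Over.homMk (𝟙 w.left) : w ⟶ Over.mk (w.hom ≫ 𝟙 X.base)) k _).trans
      (Hom.app_congr rfl (Category.id_comp k) _ _)
  comp_id {X Y} α := Hom.ext (Category.comp_id α.base) fun {w w'} k hk =>
    (α.app_map _ _ _).trans (Hom.app_congr rfl (Category.id_comp k) _ _)
  assoc {X Y Z W} α β γ := Hom.ext (Category.assoc _ _ _) fun {w w'} k hk =>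
    (Category.assoc _ _ _).trans (congrArg (_ ≫ ·)
      (Hom.app_comp_app β γ (w := Over.mk (w.hom ≫ α.base))
        (w' := Over.mk (w.hom ≫ α.base ≫ β.base)) (𝟙 w.left)
        ((Category.id_comp _).trans (Category.assoc _ _ _).symm) k _ (Category.id_comp k) _))

/-- Equality of arrows, for arrows typed in the category `OplaxSumRight p F`. -/
theorem hom_ext {X Y : OplaxSumRight p F} {α β : X ⟶ Y} (hb : α.base = β.base)
    (h : ∀ {w : Over X.base} {w' : Over Y.base} (k : w.left ⟶ w'.left)
      (hk : k ≫ w'.hom = w.hom ≫ α.base), α.app k hk = β.app k (hb ▸ hk)) : α = β :=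
  Hom.ext hb h

theorem comp_base {X Y Z : OplaxSumRight p F} (α : X ⟶ Y) (β : Y ⟶ Z) :
    (α ≫ β).base = α.base ≫ β.base := rfl

theorem id_app (X : OplaxSumRight p F) {w w' : Over X.base} (k : w.left ⟶ w'.left)
    (hk : k ≫ w'.hom = w.hom ≫ Hom.base (𝟙 X)) (m : w ⟶ w') (hm : m.left = k) :
    Hom.app (𝟙 X) k hk = X.functor.map m := by
  subst hm
  rfl

/-- A composite may be computed by factoring a square in any way. -/
theorem app_comp_app {X Y Z : OplaxSumRight p F} {α : X ⟶ Y} {β : Y ⟶ Z} {γ : X ⟶ Z}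
    (hγ : α ≫ β = γ) {w : Over X.base} {w' : Over Y.base} {w'' : Over Z.base}
    (l : w.left ⟶ w'.left) (hl : l ≫ w'.hom = w.hom ≫ α.base) (k : w'.left ⟶ w''.left)
    (hk : k ≫ w''.hom = w'.hom ≫ β.base) {m : w.left ⟶ w''.left} (h : l ≫ k = m)
    (hm : m ≫ w''.hom = w.hom ≫ γ.base) :
    α.app l hl ≫ β.app k hk = γ.app m hm := by
  subst hγ
  exact Hom.app_comp_app α β l hl k hk h hm

/-! ### Cartesian arrows of the total category -/

variable (p F) in
/-- The projection of the total category to `A`. -/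
def proj : OplaxSumRight p F ⥤ A where
  obj X := X.base
  map α := α.base

theorem base_eq_of_isHomLift {X Y : OplaxSumRight p F} (g : X.base ⟶ Y.base) (α : X ⟶ Y)
    (h : (proj p F).IsHomLift g α) : α.base = g :=
  (@IsHomLift.eq_of_isHomLift _ _ _ _ (proj p F) X Y g α h).symm

theorem isIso_app {X Y : OplaxSumRight p F} (α : X ⟶ Y) [IsIso α] {w : Over X.base}
    {w' : Over Y.base} (k : w.left ⟶ w'.left) [IsIso k] (hk : k ≫ w'.hom = w.hom ≫ α.base) :
    IsIso (α.app k hk) := by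
  have e : α.base ≫ (inv α).base = 𝟙 X.base := congrArg Hom.base (IsIso.hom_inv_id α)
  have hk' : inv k ≫ w.hom = w'.hom ≫ (inv α).base := by
    rw [IsIso.inv_comp_eq, ← Category.assoc, hk, Category.assoc, e, Category.comp_id]
  refine ⟨(inv α).app (inv k) hk', ?_, ?_⟩
  · exact (app_comp_app (IsIso.hom_inv_id α) k hk (inv k) hk' (IsIso.hom_inv_id k)
      ((Category.id_comp _).trans (Category.comp_id _).symm)).trans
      ((id_app _ _ _ (𝟙 w) rfl).trans (X.functor.map_id w))
  · exact (app_comp_app (IsIso.inv_hom_id α) (inv k) hk' k hk (IsIso.inv_hom_id k)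
      ((Category.id_comp _).trans (Category.comp_id _).symm)).trans
      ((id_app _ _ _ (𝟙 w') rfl).trans (Y.functor.map_id w'))

/-- The components are determined by those at identity arrows. -/
theorem app_eq_app_id_comp {X Y : OplaxSumRight p F} (α : X ⟶ Y) {w : Over X.base}
    {w' : Over Y.base} (k : w.left ⟶ w'.left) (hk : k ≫ w'.hom = w.hom ≫ α.base) :
    α.app k hk = α.app (w' := Over.mk (w.hom ≫ α.base)) (𝟙 w.left) (Category.id_comp _) ≫
      Y.functor.map (Over.homMk k hk : Over.mk (w.hom ≫ α.base) ⟶ w') := by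
  rw [α.app_map]
  exact Hom.app_congr rfl (Category.id_comp k).symm _ _

/-- An arrow of the total category is cartesian if its components at identity arrows are
invertible. -/
theorem isStronglyCartesian_of_isIso_app {X Y : OplaxSumRight p F} (α : X ⟶ Y)
    (hα : ∀ w : Over X.base, IsIso
      (α.app (w := w) (w' := Over.mk (w.hom ≫ α.base)) (𝟙 w.left) (Category.id_comp _))) :
    (proj p F).IsStronglyCartesian α.base α where
  toIsHomLift := IsHomLift.map (proj p F) α
  universal_property' {Z} h ψ hψ := by
    change Z.base ⟶ X.base at h
    have hb : ψ.base = h ≫ α.base := base_eq_of_isHomLift _ ψ hψ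
    have key {w : Over Z.base} {w' : Over X.base} (k : w.left ⟶ w'.left)
        (hk : k ≫ w'.hom = w.hom ≫ h) : k ≫ (Over.mk (w'.hom ≫ α.base)).hom = w.hom ≫ ψ.base := by
      rw [hb, ← Category.assoc, ← hk, Category.assoc]; rfl
    -- The factorization is forced by the formula for the components of a composite.
    let χ : Z ⟶ X :=
      { base := h
        app {w w'} k hk := ψ.app (w' := Over.mk (w'.hom ≫ α.base)) k (key k hk) ≫
          inv (α.app (w := w') (w' := Over.mk (w'.hom ≫ α.base)) (𝟙 _) (Category.id_comp _))
        isHomLift {w w'} k hk := by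
          have h₁ := α.isHomLift (w := w') (w' := Over.mk (w'.hom ≫ α.base)) (𝟙 _)
            (Category.id_comp _)
          have h₂ := ψ.isHomLift (w' := Over.mk (w'.hom ≫ α.base)) k (key k hk)
          have h₃ : F.p.IsHomLift (𝟙 (p.obj w'.left)) (α.app (w := w')
            (w' := Over.mk (w'.hom ≫ α.base)) (𝟙 _) (Category.id_comp _)) := p.map_id _ ▸ h₁
          have h₄ := @IsHomLift.lift_id_inv_isIso _ _ _ _ F.p _ _ _ _ (hα w') h₃
          have h₅ := @IsHomLift.comp _ _ _ _ F.p _ _ _ _ _ _ _ _ _ _ h₂ h₄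
          exact Category.comp_id (p.map k) ▸ h₅
        map_app m k hk := by
          rw [← Category.assoc, ψ.map_app]
        app_map {w w' w''} k hk n := by
          have e : X.functor.map n ≫ α.app (w := w'') (w' := Over.mk (w''.hom ≫ α.base)) (𝟙 _)
                (Category.id_comp _) =
              α.app (w := w') (w' := Over.mk (w'.hom ≫ α.base)) (𝟙 _) (Category.id_comp _) ≫
                Y.functor.map (Over.homMk n.left (by simp) :
                  Over.mk (w'.hom ≫ α.base) ⟶ Over.mk (w''.hom ≫ α.base)) := by
            rw [α.map_app, α.app_map]
            exact Hom.app_congr rfl ((Category.comp_id _).trans (Category.id_comp _).symm) _ _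
          rw [IsIso.eq_comp_inv, Category.assoc, Category.assoc, e, IsIso.inv_hom_id_assoc,
            ψ.app_map]
          rfl }
    refine ⟨χ, ⟨IsHomLift.map (proj p F) χ, ?_⟩, ?_⟩
    · refine hom_ext hb.symm fun {w w'} k hk => ?_
      have hk₁ : k ≫ w'.hom = (Over.mk (w.hom ≫ h)).hom ≫ α.base :=
        hk.trans (Category.assoc _ _ _).symm
      have e := app_eq_app_id_comp α (w := Over.mk (w.hom ≫ h)) k hk₁
      have e' := ψ.app_map (w := w) (w' := Over.mk ((w.hom ≫ h) ≫ α.base)) (𝟙 w.left)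
        (key (w' := Over.mk (w.hom ≫ h)) (𝟙 w.left) (Category.id_comp _))
        (Over.homMk k hk₁ : _ ⟶ w')
      refine (Category.assoc _ _ _).trans ?_
      refine (congrArg (ψ.app _ _ ≫ ·) ((IsIso.inv_comp_eq _).2 e)).trans ?_
      refine e'.trans ?_
      exact Hom.app_congr rfl (Category.id_comp k) _ _
    · rintro χ' ⟨h₁, h₂⟩
      refine hom_ext (base_eq_of_isHomLift _ χ' h₁) fun {w w'} k hk => ?_
      refine (IsIso.eq_comp_inv _).2 ?_
      exact app_comp_app h₂ _ _ _ _ (Category.comp_id k) _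

/-- The restriction of an object of the total category along an arrow of `A`. -/
def reindex (Y : OplaxSumRight p F) {a : A} (g : a ⟶ Y.base) : OplaxSumRight p F where
  base := a
  fibred := (oplaxSumMap p (overFibredMap g)).comp Y.fibred

/-- The canonical cartesian arrow from a restriction. -/
def reindexHom (Y : OplaxSumRight p F) {a : A} (g : a ⟶ Y.base) : Y.reindex g ⟶ Y where
  base := g
  app {w w'} k hk := Y.functor.map (Over.homMk k hk : (Over.map g).obj w ⟶ w')
  isHomLift {w w'} k hk := Y.isHomLift_functor_map (Over.homMk k hk : (Over.map g).obj w ⟶ w')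
  map_app {_ w w'} m k hk :=
    (Y.functor.map_comp ((Over.map g).map m)
      (Over.homMk k hk : (Over.map g).obj w ⟶ w')).symm.trans (congrArg Y.functor.map rfl)
  app_map {w w' _} k hk n :=
    (Y.functor.map_comp (Over.homMk k hk : (Over.map g).obj w ⟶ w') n).symm.trans
      (congrArg Y.functor.map rfl)

theorem isIso_reindexHom_app (Y : OplaxSumRight p F) {a : A} (g : a ⟶ Y.base)
    {w : Over (Y.reindex g).base} {w' : Over Y.base} (k : w.left ⟶ w'.left) [IsIso k]
    (hk : k ≫ w'.hom = w.hom ≫ g) : IsIso ((Y.reindexHom g).app k hk) := by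
  have : IsIso (Over.homMk k hk : (Over.map g).obj w ⟶ w') := by
    have : IsIso ((Over.forget Y.base).map (Over.homMk k hk : (Over.map g).obj w ⟶ w')) := by
      assumption
    exact isIso_of_reflects_iso _ (Over.forget Y.base)
  exact inferInstanceAs (IsIso (Y.functor.map (Over.homMk k hk : (Over.map g).obj w ⟶ w')))

theorem isStronglyCartesian_reindexHom (Y : OplaxSumRight p F) {a : A} (g : a ⟶ Y.base) :
    (proj p F).IsStronglyCartesian g (Y.reindexHom g) :=
  isStronglyCartesian_of_isIso_app _ fun _ => isIso_reindexHom_app Y g _ _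

theorem isFibered_proj : (proj p F).IsFibered :=
  Functor.IsFibered.of_exists_isStronglyCartesian fun Y _ g =>
    ⟨_, Y.reindexHom g, Y.isStronglyCartesian_reindexHom g⟩

/-- The components of a cartesian arrow of the total category at isomorphisms are invertible: it is
isomorphic to a canonical cartesian arrow, whose components are values of a functor on arrows. -/
theorem isIso_app_of_isStronglyCartesian {X Y : OplaxSumRight p F} {a b : A} (g : a ⟶ b)
    (α : X ⟶ Y) (hα : (proj p F).IsStronglyCartesian g α) {w : Over X.base} {w' : Over Y.base}
    (k : w.left ⟶ w'.left) [IsIso k] (hk : k ≫ w'.hom = w.hom ≫ α.base) :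
    IsIso (α.app k hk) := by
  obtain ⟨⟩ := hα.toIsHomLift
  have := Y.isStronglyCartesian_reindexHom α.base
  change (proj p F).IsStronglyCartesian ((proj p F).map α) (Y.reindexHom α.base) at this
  let i := Functor.IsCartesian.domainUniqueUpToIso (proj p F) ((proj p F).map α)
    (Y.reindexHom α.base) α
  have hi : i.hom ≫ Y.reindexHom α.base = α :=
    Functor.IsCartesian.fac (proj p F) ((proj p F).map α) (Y.reindexHom α.base) α
  have hib : i.hom.base = 𝟙 X.base := base_eq_of_isHomLift _ i.hom
    (Functor.IsCartesian.map_isHomLift (proj p F) ((proj p F).map α) (Y.reindexHom α.base) α)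
  have hw : 𝟙 w.left ≫ w.hom = w.hom ≫ i.hom.base :=
    (Category.id_comp _).trans ((Category.comp_id _).symm.trans (congrArg (w.hom ≫ ·) hib.symm))
  rw [← app_comp_app hi (w' := w) (𝟙 w.left) hw k hk (Category.id_comp k) hk]
  have := isIso_app i.hom (w := w) (w' := w) (𝟙 w.left) hw
  have := Y.isIso_reindexHom_app α.base (w := w) (w' := w') k hk
  infer_instance

end OplaxSumRight

/-- The right adjoint of the oplax sum along `p` on objects: the fibre over `a : A` is the category
of fibred functors from the oplax sum of `A / a` to `F`. -/
def oplaxSumRightObj (p : A ⥤ B) [p.IsFibered] (F : FibredCategory.{v₃, u₃} B) :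
    FibredCategory.{max v₃ u₁ v₁, max u₃ v₃ u₁ v₁} A where
  toBasedCategory := BasedCategory.ofFunctor (OplaxSumRight.proj p F)
  isFibered := OplaxSumRight.isFibered_proj

/-! ### The right adjoint as a pseudofunctor -/

namespace OplaxSumRight

variable (p : A ⥤ B) [p.IsFibered] {F F' : FibredCategory.{v₃, u₃} B}

/-- Postcomposition with a fibred functor, on total categories. -/
def mapFunctor (S : FibredFunctor F F') : OplaxSumRight p F ⥤ OplaxSumRight p F' where
  obj X := ⟨X.base, X.fibred.comp S⟩
  map α :=
    { base := α.base
      app k hk := S.toFunctor.map (α.app k hk)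
      isHomLift k hk :=
        BasedFunctor.preserves_isHomLift S.toBasedFunctor (p.map k) (α.app k hk)
      map_app m k hk :=
        (S.toFunctor.map_comp _ _).symm.trans (congrArg S.toFunctor.map (α.map_app m k hk))
      app_map k hk n :=
        (S.toFunctor.map_comp _ _).symm.trans (congrArg S.toFunctor.map (α.app_map k hk n)) }
  map_comp _ _ := hom_ext rfl fun _ _ => S.toFunctor.map_comp _ _

/-- The component at `X` of the transformation given by whiskering with `τ`. -/
def map₂App {S T : FibredFunctor F F'} (τ : S ⟶ T) (X : OplaxSumRight p F) :
    (mapFunctor p S).obj X ⟶ (mapFunctor p T).obj X where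
  base := 𝟙 X.base
  app {w w'} k hk := S.toFunctor.map (Hom.app (𝟙 X) k hk) ≫ τ.toNatTrans.app (X.functor.obj w')
  isHomLift {w w'} k hk := by
    have h₁ : F'.p.IsHomLift (p.map k) (S.toFunctor.map (Hom.app (𝟙 X) k hk)) :=
      @BasedFunctor.preserves_isHomLift _ _ _ _ S.toBasedFunctor _ _ _ _ (p.map k)
        (Hom.app (𝟙 X) k hk) (Hom.isHomLift (𝟙 X) k hk)
    have h₂ : F'.p.IsHomLift (𝟙 (p.obj w'.left)) (τ.toNatTrans.app (X.functor.obj w')) :=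
      BasedNatTrans.isHomLift τ (X.functor_obj w')
    exact Category.comp_id (p.map k) ▸ @IsHomLift.comp _ _ _ _ F'.p _ _ _ _ _ _ _ _ _ _ h₁ h₂
  map_app m k hk :=
    (Category.assoc _ _ _).symm.trans (congrArg (· ≫ _)
      ((S.toFunctor.map_comp _ _).symm.trans
        (congrArg S.toFunctor.map (Hom.map_app (𝟙 X) m k hk))))
  app_map {w w' w''} k hk n := by
    refine (Category.assoc _ _ _).trans ?_
    refine (congrArg (_ ≫ ·) (τ.toNatTrans.naturality (X.functor.map n)).symm).trans ?_
    refine (Category.assoc _ _ _).symm.trans (congrArg (· ≫ _) ?_)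
    exact (S.toFunctor.map_comp _ _).symm.trans
      (congrArg S.toFunctor.map (Hom.app_map (𝟙 X) k hk n))

end OplaxSumRight

variable (p : A ⥤ B) [p.IsFibered]

/-- The right adjoint on fibred functors, given by postcomposition. -/
def oplaxSumRightMap {F F' : FibredCategory.{v₃, u₃} B} (S : FibredFunctor F F') :
    FibredFunctor (oplaxSumRightObj p F) (oplaxSumRightObj p F') where
  toFunctor := OplaxSumRight.mapFunctor p S
  w := rfl
  map_cartesian f x y φ hφ := by
    refine BasedFunctor.isStronglyCartesian_map_of_cleavage
      (X := (oplaxSumRightObj p F).toBasedCategory) (Y := (oplaxSumRightObj p F').toBasedCategory)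
      { toFunctor := OplaxSumRight.mapFunctor p S, w := rfl } (fun Y r g => ?_) f φ hφ
    exact ⟨_, OplaxSumRight.reindexHom Y g, OplaxSumRight.isStronglyCartesian_reindexHom Y g,
      OplaxSumRight.isStronglyCartesian_reindexHom ((OplaxSumRight.mapFunctor p S).obj Y) g⟩

/-- The right adjoint on fibred natural transformations, given by whiskering. -/
def oplaxSumRightMap₂ {F F' : FibredCategory.{v₃, u₃} B} {S T : FibredFunctor F F'} (τ : S ⟶ T) :
    oplaxSumRightMap p S ⟶ oplaxSumRightMap p T where
  toNatTrans :=
    { app := OplaxSumRight.map₂App p τ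
      naturality X Y α := by
        refine OplaxSumRight.hom_ext ((Category.comp_id α.base).trans (Category.id_comp _).symm)
          fun {w w'} k hk => ?_
        have e : OplaxSumRight.Hom.app (α ≫ 𝟙 Y) k hk = OplaxSumRight.Hom.app (𝟙 X ≫ α) k
            (hk.trans (congrArg (w.hom ≫ ·)
              ((Category.comp_id α.base).trans (Category.id_comp _).symm))) :=
          OplaxSumRight.Hom.app_congr (by rw [Category.comp_id, Category.id_comp]) rfl _ _
        refine (Category.assoc _ _ _).symm.trans ?_
        refine (congrArg (· ≫ _) ((S.toFunctor.map_comp _ _).symm.trans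
          ((congrArg S.toFunctor.map e).trans (S.toFunctor.map_comp _ _)))).trans ?_
        refine (Category.assoc _ _ _).trans (Eq.trans ?_ (Category.assoc _ _ _).symm)
        exact congrArg (_ ≫ ·) (τ.toNatTrans.naturality _) }
  isHomLift' X := IsHomLift.map (OplaxSumRight.proj p F') (OplaxSumRight.map₂App p τ X)

theorem oplaxSumRightMap₂_id {F F' : FibredCategory.{v₃, u₃} B} (S : FibredFunctor F F') :
    oplaxSumRightMap₂ p (𝟙 S) = 𝟙 (oplaxSumRightMap p S) :=
  FibredFunctor.hom_ext _ _ fun _ => OplaxSumRight.hom_ext rfl fun _ _ => Category.comp_id _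

theorem oplaxSumRightMap₂_comp {F F' : FibredCategory.{v₃, u₃} B} {S T U : FibredFunctor F F'}
    (σ : S ⟶ T) (τ : T ⟶ U) :
    oplaxSumRightMap₂ p (σ ≫ τ) = oplaxSumRightMap₂ p σ ≫ oplaxSumRightMap₂ p τ :=
  FibredFunctor.hom_ext _ _ fun (X : OplaxSumRight p F) => by
    refine OplaxSumRight.hom_ext (Category.comp_id (𝟙 X.base)).symm fun {w w'} k hk => ?_
    have hk' : k ≫ w'.hom = (w.hom ≫ 𝟙 X.base) ≫ 𝟙 X.base :=
      hk.trans (Category.comp_id _).symm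
    have e : OplaxSumRight.Hom.app (𝟙 X) (w := w) k hk =
        OplaxSumRight.Hom.app (𝟙 X) (w' := Over.mk (w.hom ≫ 𝟙 X.base)) (𝟙 w.left)
          (Category.id_comp _) ≫
        OplaxSumRight.Hom.app (𝟙 X) (w := Over.mk (w.hom ≫ 𝟙 X.base)) k hk' :=
      (OplaxSumRight.app_comp_app (Category.comp_id (𝟙 X)) (w := w)
        (w' := Over.mk (w.hom ≫ 𝟙 X.base)) (w'' := w') (𝟙 w.left) (Category.id_comp _) k hk'
        (Category.id_comp k) hk).symm
    refine (Category.assoc _ _ _).symm.trans (Eq.trans ?_ (Category.assoc _ _ _))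
    refine congrArg (· ≫ τ.toNatTrans.app _) ?_
    refine (congrArg (S.toFunctor.map · ≫ _) e).trans ?_
    refine (congrArg (· ≫ _) (S.toFunctor.map_comp _ _)).trans ?_
    refine (Category.assoc _ _ _).trans (Eq.trans ?_ (Category.assoc _ _ _).symm)
    exact congrArg (_ ≫ ·) (σ.toNatTrans.naturality _)

/-- The right adjoint of the oplax sum along `p`. -/
def oplaxSumRight (p : A ⥤ B) [p.IsFibered] :
    StrictPseudofunctor (FibredCategory.{max v u₁ v₁, max u v u₁ v₁} B)
      (FibredCategory.{max v u₁ v₁, max u v u₁ v₁} A) where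
  obj := oplaxSumRightObj p
  map := oplaxSumRightMap p
  map₂ := oplaxSumRightMap₂ p
  map₂_id := oplaxSumRightMap₂_id p
  map₂_comp := oplaxSumRightMap₂_comp p
  mapId _ := Iso.refl _
  mapComp _ _ := Iso.refl _
  mapId_eq_eqToIso _ := rfl
  mapComp_eq_eqToIso _ _ := rfl
  map₂_whisker_left _ _ _ _ := FibredCategory.hom₂_ext _ _ fun _ =>
    ((Category.id_comp _).trans (Category.comp_id _)).symm
  map₂_whisker_right _ U := FibredCategory.hom₂_ext _ _ fun _ => by
    refine Eq.trans ?_ ((Category.id_comp _).trans (Category.comp_id _)).symm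
    exact OplaxSumRight.hom_ext rfl fun _ _ => (U.toFunctor.map_comp _ _).symm
  map₂_associator S T U := by
    refine (oplaxSumRightMap₂_id p _).trans (FibredCategory.hom₂_ext _ _ fun X => ?_)
    change 𝟙 _ = 𝟙 _ ≫ (oplaxSumRightMap p U).toFunctor.map
      (𝟙 ((OplaxSumRight.mapFunctor p T).obj ((OplaxSumRight.mapFunctor p S).obj X))) ≫
        𝟙 _ ≫ 𝟙 _ ≫ 𝟙 _
    simp only [Category.id_comp, Category.comp_id]
    exact (CategoryTheory.Functor.map_id _ _).symm
  map₂_left_unitor S := by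
    refine (oplaxSumRightMap₂_id p _).trans (FibredCategory.hom₂_ext _ _ fun X => ?_)
    change 𝟙 _ = 𝟙 _ ≫ (oplaxSumRightMap p S).toFunctor.map (𝟙 _) ≫ 𝟙 _
    simp
  map₂_right_unitor S := by
    refine (oplaxSumRightMap₂_id p _).trans (FibredCategory.hom₂_ext _ _ fun X => ?_)
    change 𝟙 _ = 𝟙 _ ≫ 𝟙 _ ≫ 𝟙 _
    simp

/-! ### The counit -/

/-- Evaluation at identities, as a functor on the total category. -/
def OplaxSumRight.evalFunctor (F : FibredCategory.{v₃, u₃} B) : OplaxSumRight p F ⥤ F.obj where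
  obj X := X.functor.obj (Over.mk (𝟙 X.base))
  map α := α.app (w := Over.mk (𝟙 _)) (w' := Over.mk (𝟙 _)) α.base
    ((Category.comp_id _).trans (Category.id_comp _).symm)
  map_id X := (OplaxSumRight.id_app X _ _ (𝟙 _) rfl).trans (X.functor.map_id _)
  map_comp α β := (OplaxSumRight.app_comp_app (α := α) (β := β) rfl (w := Over.mk (𝟙 _))
    (w' := Over.mk (𝟙 _)) (w'' := Over.mk (𝟙 _)) α.base _ β.base _ rfl _).symm

/-- Evaluation at identities commutes with the projections to `B`. -/
def OplaxSumRight.evalBasedFunctor (F : FibredCategory.{v₃, u₃} B) :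
    BasedFunctor (oplaxSumObj p (oplaxSumRightObj p F)).toBasedCategory F.toBasedCategory where
  toFunctor := OplaxSumRight.evalFunctor p F
  w := CategoryTheory.Functor.ext (fun X : OplaxSumRight p F => X.functor_obj _)
    fun (X Y : OplaxSumRight p F) (α : OplaxSumRight.Hom X Y) =>
      @IsHomLift.fac' _ _ _ _ F.p _ _ _ _ _ _ (OplaxSumRight.Hom.isHomLift α
        (w := Over.mk (𝟙 _)) (w' := Over.mk (𝟙 _)) α.base _)

/-- The counit of the pseudo-adjunction: evaluation at identities is a fibred functor over `B`. It
sends the canonical cartesian arrow from the restriction of `Y` along `g` to the value of `Y` at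
`g`, regarded as an arrow of the slice from `g` to the identity, which is cartesian if `g` is. -/
def oplaxSumCounit (F : FibredCategory.{v₃, u₃} B) :
    FibredFunctor (oplaxSumObj p (oplaxSumRightObj p F)) F where
  toBasedFunctor := OplaxSumRight.evalBasedFunctor p F
  map_cartesian := by
    refine BasedFunctor.isStronglyCartesian_map_of_cleavage (OplaxSumRight.evalBasedFunctor p F)
      fun (Y : OplaxSumRight p F) r f => ?_
    change r ⟶ p.obj Y.base at f
    obtain ⟨a, g, hg⟩ := Functor.IsPreFibered.exists_isCartesian' (p := p) f
    have hg' : p.IsStronglyCartesian f g := inferInstance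
    refine ⟨Y.reindex g, Y.reindexHom g, isStronglyCartesian_comp (OplaxSumRight.proj p F) p f g _
      hg' (Y.isStronglyCartesian_reindexHom g), ?_⟩
    exact Y.isStronglyCartesian_functor_map _ f hg'

/-! ### Transposition -/

/-- The transposition functor: apply the oplax sum and compose with the counit. -/
def oplaxSumTranspose (E : FibredCategory.{max v₃ u₁ v₁, max u₃ v₃ u₁ v₁} A)
    (F : FibredCategory.{v₃, u₃} B) :
    FibredFunctor E (oplaxSumRightObj p F) ⥤ FibredFunctor (oplaxSumObj p E) F where
  obj H := (oplaxSumMap p H).comp (oplaxSumCounit p F)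
  map θ := BasedCategory.whiskerRight (oplaxSumMap₂ p θ) (oplaxSumCounit p F).toBasedFunctor
  map_id H := BasedNatTrans.ext _ _ <| NatTrans.ext <| funext fun x =>
    (OplaxSumRight.evalFunctor p F).map_id (H.toFunctor.obj x)
  map_comp θ θ' := by
    refine BasedNatTrans.ext _ _ (NatTrans.ext (funext fun x => ?_))
    exact (OplaxSumRight.evalFunctor p F).map_comp (θ.toNatTrans.app x) (θ'.toNatTrans.app x)

variable {p}

/-- The base of a cartesian arrow may be replaced by its image under the projection. -/
theorem isStronglyCartesian_map {X : Type u₃} [Category.{v₃} X] {q : X ⥤ A} {a b : A} (f : a ⟶ b)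
    {x y : X} (φ : x ⟶ y) (h : q.IsStronglyCartesian f φ) :
    q.IsStronglyCartesian (q.map φ) φ := by
  obtain ⟨⟩ := h.toIsHomLift
  exact h

namespace OplaxSumRight

/-! ### Transposition is fully faithful -/

section Eval

variable {F : FibredCategory.{v₃, u₃} B}

/-- The value of an object of the total category at the identity. -/
def pt (X : OplaxSumRight p F) : F.obj := (evalFunctor p F).obj X

/-- The action of an arrow on values at identities. -/
def ptMap {X Y : OplaxSumRight p F} (α : X ⟶ Y) : X.pt ⟶ Y.pt := (evalFunctor p F).map α

/-- The component of an arrow `α : X ⟶ Y` from the identity object of the first slice. -/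
def Hom.eval {X Y : OplaxSumRight p F} (α : X ⟶ Y) (w : Over Y.base) (i : X.base ⟶ w.left)
    (hi : i ≫ w.hom = α.base) : X.pt ⟶ Y.functor.obj w :=
  α.app (w := Over.mk (𝟙 _)) i (hi.trans (Category.id_comp _).symm)

theorem Hom.isHomLift_eval {X Y : OplaxSumRight p F} (α : X ⟶ Y) (w : Over Y.base)
    (i : X.base ⟶ w.left) (hi : i ≫ w.hom = α.base) :
    F.p.IsHomLift (p.map i) (Hom.eval α w i hi) :=
  α.isHomLift (w := Over.mk (𝟙 _)) _ _

theorem eval_congr {X Y : OplaxSumRight p F} {α β : X ⟶ Y} (h : α = β) (w : Over Y.base)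
    {i i' : X.base ⟶ w.left} (hii : i = i') (hi : i ≫ w.hom = α.base)
    (hi' : i' ≫ w.hom = β.base) : Hom.eval α w i hi = Hom.eval β w i' hi' := by
  subst h hii
  rfl

theorem eval_comp_map {X Y : OplaxSumRight p F} (α : X ⟶ Y) {w w' : Over Y.base}
    (i : X.base ⟶ w.left) (hi : i ≫ w.hom = α.base) (m : w ⟶ w') :
    Hom.eval α w i hi ≫ Y.functor.map m =
      Hom.eval α w' (i ≫ m.left) (by rw [Category.assoc, Over.w, hi]) :=
  α.app_map _ _ _

theorem eval_comp_app {X Y Z : OplaxSumRight p F} {α : X ⟶ Y} {β : Y ⟶ Z} {γ : X ⟶ Z}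
    (hγ : α ≫ β = γ) {w : Over Y.base} {w' : Over Z.base} (i : X.base ⟶ w.left)
    (hi : i ≫ w.hom = α.base) (k : w.left ⟶ w'.left) (hk : k ≫ w'.hom = w.hom ≫ β.base)
    {m : X.base ⟶ w'.left} (hm : i ≫ k = m) (hm' : m ≫ w'.hom = γ.base) :
    Hom.eval α w i hi ≫ β.app k hk = Hom.eval γ w' m hm' :=
  app_comp_app hγ (w := Over.mk (𝟙 _)) _ _ _ _ hm _

theorem ptMap_comp_eval {X Y Z : OplaxSumRight p F} {α : X ⟶ Y} {β : Y ⟶ Z} {γ : X ⟶ Z}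
    (hγ : α ≫ β = γ) {w : Over Z.base} (i : Y.base ⟶ w.left) (hi : i ≫ w.hom = β.base)
    {m : X.base ⟶ w.left} (hm : α.base ≫ i = m) (hm' : m ≫ w.hom = γ.base) :
    ptMap α ≫ Hom.eval β w i hi = Hom.eval γ w m hm' :=
  app_comp_app hγ (w := Over.mk (𝟙 _)) (w' := Over.mk (𝟙 _)) _ _ _ _ hm _

theorem isIso_eval {X Y : OplaxSumRight p F} {a b : A} (g : a ⟶ b)
    (α : X ⟶ Y) (hα : (proj p F).IsStronglyCartesian g α) {w : Over Y.base} (i : X.base ⟶ w.left)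
    [IsIso i] (hi : i ≫ w.hom = α.base) : IsIso (Hom.eval α w i hi) := by
  have : IsIso (C := A) (X := (Over.mk (𝟙 X.base)).left) i := by assumption
  exact isIso_app_of_isStronglyCartesian g α hα (w := Over.mk (𝟙 _)) i _

end Eval

section FullyFaithful

variable {E : FibredCategory.{max v₃ u₁ v₁, max u₃ v₃ u₁ v₁} A} {F : FibredCategory.{v₃, u₃} B}

/-- The value of a fibred functor, as an object of the total category of the right adjoint. -/
abbrev value (H : FibredFunctor E (oplaxSumRightObj p F)) (e : E.obj) : OplaxSumRight p F :=
  H.toFunctor.obj e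

/-- The value of a fibred functor on an arrow. -/
abbrev valueMap (H : FibredFunctor E (oplaxSumRightObj p F)) {e e' : E.obj} (φ : e ⟶ e') :
    value H e ⟶ value H e' :=
  H.toFunctor.map φ

theorem valueMap_comp (H : FibredFunctor E (oplaxSumRightObj p F)) {e e' e'' : E.obj} (φ : e ⟶ e')
    (ψ : e' ⟶ e'') : valueMap H φ ≫ valueMap H ψ = valueMap H (φ ≫ ψ) :=
  (H.toFunctor.map_comp φ ψ).symm

/-- The comparison of the bases of the values of two fibred functors. These bases agree, but not
definitionally. -/
def baseComparison (H H' : FibredFunctor E (oplaxSumRightObj p F)) (e : E.obj) :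
    (value H e).base ⟶ (value H' e).base :=
  (eqToHom (H.w.trans H'.w.symm) :
    H.toFunctor ⋙ (oplaxSumRightObj p F).p ⟶ H'.toFunctor ⋙ (oplaxSumRightObj p F).p).app e

theorem baseComparison_naturality (H H' : FibredFunctor E (oplaxSumRightObj p F)) {e e' : E.obj}
    (φ : e ⟶ e') : (valueMap H φ).base ≫ baseComparison H H' e' =
      baseComparison H H' e ≫ (valueMap H' φ).base :=
  (eqToHom (H.w.trans H'.w.symm) : H.toFunctor ⋙ (oplaxSumRightObj p F).p ⟶
    H'.toFunctor ⋙ (oplaxSumRightObj p F).p).naturality φ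

theorem baseComparison_comp (H H' : FibredFunctor E (oplaxSumRightObj p F)) (e : E.obj) :
    baseComparison H H' e ≫ baseComparison H' H e = 𝟙 _ := by
  refine (NatTrans.comp_app _ _ _).symm.trans ?_
  rw [eqToHom_trans]
  rfl

theorem baseComparison_eq (H H' : FibredFunctor E (oplaxSumRightObj p F)) (e : E.obj) :
    baseComparison H H' e = eqToHom ((H.w_obj e).trans (H'.w_obj e).symm) :=
  eqToHom_app _ _

theorem base_app_eq_baseComparison {H H' : FibredFunctor E (oplaxSumRightObj p F)} (θ : H ⟶ H')
    (e : E.obj) : Hom.base (θ.toNatTrans.app e) = baseComparison H H' e := by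
  have h := θ.isHomLift' e
  have h' := @IsHomLift.fac' _ _ _ _ (proj p F) _ _ _ _ _ _ h
  refine h'.trans ?_
  rw [baseComparison_eq, Category.id_comp]
  exact eqToHom_trans _ _

/-- Every object of the slice over the base of `H e` is, up to isomorphism, the base of `H φ` for a
cartesian arrow `φ` of `E` with codomain `e`. -/
theorem exists_lift (H : FibredFunctor E (oplaxSumRightObj p F)) (e : E.obj)
    (w : Over (value H e).base) : ∃ (e' : E.obj) (φ : e' ⟶ e) (i : (value H e').base ≅ w.left),
      i.hom ≫ w.hom = (valueMap H φ).base ∧ E.p.IsStronglyCartesian (E.p.map φ) φ := by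
  have hq : (H.toFunctor ⋙ (oplaxSumRightObj p F).p).IsFibered := H.w ▸ E.isFibered
  obtain ⟨e', φ, hφ⟩ := Functor.IsPreFibered.exists_isCartesian'
    (p := H.toFunctor ⋙ (oplaxSumRightObj p F).p) (a := e) w.hom
  have hφ' : (H.toFunctor ⋙ (oplaxSumRightObj p F).p).IsStronglyCartesian w.hom φ :=
    @Functor.IsFibered.isStronglyCartesian_of_isCartesian _ _ _ _ _ hq _ _ w.hom _ _ φ hφ
  have hd : (value H e').base = w.left := IsHomLift.domain_eq
    (H.toFunctor ⋙ (oplaxSumRightObj p F).p) w.hom φ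
  have hf := IsHomLift.fac' (H.toFunctor ⋙ (oplaxSumRightObj p F).p) w.hom φ
  refine ⟨e', φ, eqToIso hd, ?_, ?_⟩
  · refine Eq.trans ?_ hf.symm
    exact congrArg (eqToHom hd ≫ ·) (Category.comp_id w.hom).symm
  · rw [H.w] at hφ'
    exact isStronglyCartesian_map w.hom φ hφ'

/-- The universal property of a cartesian arrow of `E`, expressed through the bases of the values
of `H`. -/
theorem exists_factor (H : FibredFunctor E (oplaxSumRightObj p F)) {e e' e'' : E.obj} (u : e'' ⟶ e)
    (φ : e' ⟶ e) (hφ : E.p.IsStronglyCartesian (E.p.map φ) φ)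
    (g : (value H e'').base ⟶ (value H e').base)
    (hg : g ≫ (valueMap H φ).base = (valueMap H u).base) :
    ∃ χ : e'' ⟶ e', χ ≫ φ = u ∧ (valueMap H χ).base = g := by
  have key : ∀ (q : E.obj ⥤ A), q = E.p → q.IsStronglyCartesian (q.map φ) φ := by
    rintro _ rfl; exact hφ
  have := key (H.toFunctor ⋙ (oplaxSumRightObj p F).p) H.w
  have hu : (H.toFunctor ⋙ (oplaxSumRightObj p F).p).IsHomLift
      (g ≫ (H.toFunctor ⋙ (oplaxSumRightObj p F).p).map φ) u := by
    have := IsHomLift.map (H.toFunctor ⋙ (oplaxSumRightObj p F).p) u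
    exact hg ▸ this
  obtain ⟨χ, ⟨h₁, h₂⟩, -⟩ :=
    @Functor.IsStronglyCartesian.universal_property' _ _ _ _ _ _ _ _ _ _ _ this e'' g u hu
  exact ⟨χ, h₂, (@IsHomLift.eq_of_isHomLift _ _ _ _ (H.toFunctor ⋙ (oplaxSumRightObj p F).p)
    e'' e' g χ h₁).symm⟩

variable {H H' : FibredFunctor E (oplaxSumRightObj p F)}

/-- The component at `e` of a transformation between transposes. -/
def transposedApp (τ : (oplaxSumTranspose p E F).obj H ⟶ (oplaxSumTranspose p E F).obj H')
    (e : E.obj) :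
    (value H e).pt ⟶ (value H' e).pt :=
  τ.toNatTrans.app e

/-- The components of a transformation between transposes are vertical, up to the comparison of the
bases. -/
theorem isHomLift_baseComparison (τ : (oplaxSumTranspose p E F).obj H ⟶
    (oplaxSumTranspose p E F).obj H') (e : E.obj) :
    F.p.IsHomLift (p.map (baseComparison H H' e)) (transposedApp τ e) := by
  have h := BasedNatTrans.isHomLift τ (a := e) (S := p.obj (value H e).base)
    (congrArg p.obj (H.w_obj e).symm)
  have e' : p.map (baseComparison H H' e) = 𝟙 (p.obj (value H e).base) ≫
      eqToHom (congrArg p.obj ((H.w_obj e).trans (H'.w_obj e).symm)) := by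
    rw [Category.id_comp, baseComparison_eq]
    exact eqToHom_map p _
  rw [e']
  exact (IsHomLift.lift_comp_eqToHom_iff _ _ _ _).2 h

theorem lift_base_eq (e e'' : E.obj) (u : e'' ⟶ e)
    {w : Over (value H e).base} (i : (value H e'').base ⟶ w.left)
    (hi : i ≫ w.hom = (valueMap H u).base) {w' : Over (value H' e).base} (k : w.left ⟶ w'.left)
    (hk : k ≫ w'.hom = w.hom ≫ baseComparison H H' e) :
    (baseComparison H' H e'' ≫ i ≫ k) ≫ w'.hom = (valueMap H' u).base := by
  rw [Category.assoc, Category.assoc, hk, ← Category.assoc i, hi, baseComparison_naturality,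
    ← Category.assoc, baseComparison_comp, Category.id_comp]

/-- A transformation `τ` between transposes extends to an arrow between values at `e`. Its
components are characterized through the components of `H u`, `H' u` and `τ` for arbitrary
`u : e'' ⟶ e`; on a cartesian `u` lying over an object `w` of the slice the component of `H u` is
invertible, which gives the definition. -/
theorem exists_hom (τ : (oplaxSumTranspose p E F).obj H ⟶
    (oplaxSumTranspose p E F).obj H') (e : E.obj) :
    ∃ (θ : value H e ⟶ value H' e) (hθ : θ.base = baseComparison H H' e),
      ∀ (e'' : E.obj) (u : e'' ⟶ e)
        {w : Over (value H e).base} (i : (value H e'').base ⟶ w.left)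
        (hi : i ≫ w.hom = (valueMap H u).base) {w' : Over (value H' e).base} (k : w.left ⟶ w'.left)
        (hk : k ≫ w'.hom = w.hom ≫ baseComparison H H' e),
        Hom.eval (valueMap H u) w i hi ≫ θ.app k (hθ ▸ hk) =
          transposedApp τ e'' ≫ Hom.eval (valueMap H' u) w' (baseComparison H' H e'' ≫ i ≫ k)
            (lift_base_eq e e'' u i hi k hk) := by
  choose L φ i hi hφ using exists_lift H e
  have hiso (w : Over (value H e).base) :
      IsIso (Hom.eval (valueMap H (φ w)) w (i w).hom (hi w)) :=
    isIso_eval _ _ (H.map_cartesian _ _ (hφ w)) _ _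
  -- The formula holds for every `u` since `u` factors through the chosen lift `φ w`.
  have key {e'' : E.obj} (u : e'' ⟶ e)
        {w : Over (value H e).base} (i₂ : (value H e'').base ⟶ w.left)
        (hi₂ : i₂ ≫ w.hom = (valueMap H u).base) {w' : Over (value H' e).base}
        (k : w.left ⟶ w'.left)
        (hk : k ≫ w'.hom = w.hom ≫ baseComparison H H' e) :
      Hom.eval (valueMap H u) w i₂ hi₂ ≫ inv (Hom.eval (valueMap H (φ w)) w (i w).hom (hi w)) ≫
        transposedApp τ (L w) ≫ Hom.eval (valueMap H' (φ w)) w'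
          (baseComparison H' H (L w) ≫ (i w).hom ≫ k)
          (lift_base_eq e (L w) (φ w) (i w).hom (hi w) k hk) =
      transposedApp τ e'' ≫ Hom.eval (valueMap H' u) w' (baseComparison H' H e'' ≫ i₂ ≫ k)
            (lift_base_eq e e'' u i₂ hi₂ k hk) := by
    obtain ⟨χ, hχ, hχb⟩ := exists_factor H u (φ w) (hφ w) (i₂ ≫ (i w).inv) (by
      rw [← hi w, Category.assoc, Iso.inv_hom_id_assoc, hi₂])
    have h₁ := ptMap_comp_eval ((valueMap_comp H χ (φ w)).trans (congrArg _ hχ)) (i w).hom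
      (hi w) (m := i₂) (by rw [hχb, Category.assoc, Iso.inv_hom_id, Category.comp_id]) hi₂
    have h₂ := ptMap_comp_eval ((valueMap_comp H' χ (φ w)).trans (congrArg _ hχ))
      (baseComparison H' H (L w) ≫ (i w).hom ≫ k)
      (lift_base_eq e (L w) (φ w) (i w).hom (hi w) k hk)
      (m := baseComparison H' H e'' ≫ i₂ ≫ k) (by
        rw [← Category.assoc, baseComparison_naturality, hχb]
        simp) (lift_base_eq e e'' u i₂ hi₂ k hk)
    have h₃ : ptMap (valueMap H χ) ≫ transposedApp τ (L w) =
        transposedApp τ e'' ≫ ptMap (valueMap H' χ) := τ.toNatTrans.naturality χ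
    rw [← h₁, ← h₂, Category.assoc, IsIso.hom_inv_id_assoc, ← Category.assoc, h₃, Category.assoc]
  let θ : value H e ⟶ value H' e :=
    { base := baseComparison H H' e
      app {w w'} k hk := inv (Hom.eval (valueMap H (φ w)) w (i w).hom (hi w)) ≫
        transposedApp τ (L w) ≫ Hom.eval (valueMap H' (φ w)) w'
          (baseComparison H' H (L w) ≫ (i w).hom ≫ k)
          (lift_base_eq e (L w) (φ w) (i w).hom (hi w) k hk)
      isHomLift {w w'} k hk := by
        have h₁ := Hom.isHomLift_eval (valueMap H (φ w)) w (i w).hom (hi w)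
        have h₂ := @IsHomLift.inv _ _ _ _ F.p _ _ _ _ _ _ _ (hiso w) h₁
        have h₃ := isHomLift_baseComparison τ (L w)
        have h₄ := Hom.isHomLift_eval (valueMap H' (φ w)) w' _
          (lift_base_eq e (L w) (φ w) (i w).hom (hi w) k hk)
        have h₅ := @IsHomLift.comp _ _ _ _ F.p _ _ _ _ _ _ _ _ _ _ h₃ h₄
        have h₆ := @IsHomLift.comp _ _ _ _ F.p _ _ _ _ _ _ _ _ _ _ h₂ h₅
        have e₁ : inv (p.map (i w).hom) ≫ p.map (baseComparison H H' (L w)) ≫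
            p.map (baseComparison H' H (L w) ≫ (i w).hom ≫ k) = p.map k := by
          rw [← p.map_comp, ← Category.assoc, baseComparison_comp, Category.id_comp, p.map_comp,
            IsIso.inv_hom_id_assoc]
        exact e₁ ▸ h₆
      map_app {w₁ w w'} m k hk := by
        rw [IsIso.eq_inv_comp, ← Category.assoc, eval_comp_map, key _ _ _ _ hk]
        exact congrArg (_ ≫ ·) (eval_congr rfl _ (by simp) _ _)
      app_map {w w' w₁'} k hk n := by
        rw [Category.assoc, Category.assoc, eval_comp_map]
        exact congrArg (_ ≫ _ ≫ ·) (eval_congr rfl _ (by simp) _ _) }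
  exact ⟨θ, rfl, fun e'' u w i₂ hi₂ w' k hk => key u i₂ hi₂ k hk⟩

/-- The formula of `exists_hom` holds for the components of every transformation. -/
theorem eval_comp_natTrans_app {H H' : FibredFunctor E (oplaxSumRightObj p F)} (θ : H ⟶ H')
    {e e'' : E.obj} (u : e'' ⟶ e) {w : Over (value H e).base} (i : (value H e'').base ⟶ w.left)
    (hi : i ≫ w.hom = (valueMap H u).base) {w' : Over (value H' e).base} (k : w.left ⟶ w'.left)
    (hk : k ≫ w'.hom = w.hom ≫ Hom.base (θ.toNatTrans.app e))
    (hk' : k ≫ w'.hom = w.hom ≫ baseComparison H H' e) :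
    Hom.eval (valueMap H u) w i hi ≫ Hom.app (θ.toNatTrans.app e) k hk =
      ptMap (θ.toNatTrans.app e'') ≫ Hom.eval (valueMap H' u) w' (baseComparison H' H e'' ≫ i ≫ k)
        (lift_base_eq e e'' u i hi k hk') := by
  have hm : (i ≫ k) ≫ w'.hom = Hom.base (valueMap H u ≫ θ.toNatTrans.app e) := by
    rw [Category.assoc, hk, ← Category.assoc, hi]
    rfl
  refine (eval_comp_app rfl i hi k hk rfl hm).trans (Eq.symm ?_)
  refine ptMap_comp_eval (θ.toNatTrans.naturality u).symm _ _ ?_ hm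
  rw [base_app_eq_baseComparison, ← Category.assoc, baseComparison_comp, Category.id_comp]

theorem eval_valueMap_id (H : FibredFunctor E (oplaxSumRightObj p F)) (e : E.obj)
    (i : (value H e).base ⟶ (value H e).base) (hi : i = 𝟙 _)
    (hi' : i ≫ (Over.mk (𝟙 (value H e).base)).hom = (valueMap H (𝟙 e)).base) :
    Hom.eval (valueMap H (𝟙 e)) (Over.mk (𝟙 _)) i hi' = 𝟙 (value H e).pt := by
  subst hi
  refine (eval_congr (H.toFunctor.map_id e) (Over.mk (𝟙 _)) rfl hi' (Category.id_comp _)).trans ?_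
  exact (id_app (value H e) _ _ (𝟙 (Over.mk (𝟙 _))) rfl).trans ((value H e).functor.map_id _)

/-- A transformation is determined by its transpose, because the cartesian arrows `e' ⟶ e` exhibit
every component at `e` as a component at the identity of the base of `e'`. -/
instance faithful_oplaxSumTranspose : (oplaxSumTranspose p E F).Faithful where
  map_injective {H H' θ θ'} h := by
    refine BasedNatTrans.ext _ _ (NatTrans.ext (funext fun e => ?_))
    refine OplaxSumRight.hom_ext ((base_app_eq_baseComparison θ e).trans
      (base_app_eq_baseComparison θ' e).symm) fun {w w'} k hk => ?_
    obtain ⟨L, φ, i, hi, hφ⟩ := exists_lift H e w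
    have : IsIso (Hom.eval (valueMap H φ) w i.hom hi) :=
      isIso_eval _ _ (H.map_cartesian _ _ hφ) _ _
    have hk' := hk.trans (congrArg (w.hom ≫ ·) (base_app_eq_baseComparison θ e))
    have h' : ptMap (θ.toNatTrans.app L) = ptMap (θ'.toNatTrans.app L) :=
      congrArg (fun τ => τ.toNatTrans.app L) h
    rw [← cancel_epi (Hom.eval (valueMap H φ) w i.hom hi)]
    refine (eval_comp_natTrans_app θ φ i.hom hi k hk hk').trans ?_
    rw [h']
    exact (eval_comp_natTrans_app θ' φ i.hom hi k _ hk').symm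

/-- Every transformation between transposes is a transpose: the arrows of `exists_hom` are
natural, as one checks after composing with the invertible components of cartesian arrows. -/
instance full_oplaxSumTranspose : (oplaxSumTranspose p E F).Full where
  map_surjective {H H'} τ := by
    choose θ hθ h using exists_hom τ
    have hnat {e e₁ : E.obj} (v : e ⟶ e₁) : valueMap H v ≫ θ e₁ = θ e ≫ valueMap H' v := by
      refine OplaxSumRight.hom_ext ?_ fun {w w'} k hk => ?_
      · rw [comp_base, comp_base, hθ, hθ, baseComparison_naturality]
      obtain ⟨L, φ, i, hi, hφ⟩ := exists_lift H e w
      have : IsIso (Hom.eval (valueMap H φ) w i.hom hi) :=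
        isIso_eval _ _ (H.map_cartesian _ _ hφ) _ _
      rw [← cancel_epi (Hom.eval (valueMap H φ) w i.hom hi)]
      have hk₁ : k ≫ w'.hom = w.hom ≫ (valueMap H v).base ≫ baseComparison H H' e₁ :=
        hk.trans (congrArg (fun g => w.hom ≫ (valueMap H v).base ≫ g) (hθ e₁))
      have hk₂ : k ≫ w'.hom = (w.hom ≫ baseComparison H H' e) ≫ (valueMap H' v).base := by
        rw [hk₁, baseComparison_naturality, Category.assoc]
      have hi₁ : i.hom ≫ w.hom ≫ (valueMap H v).base = (valueMap H (φ ≫ v)).base := by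
        rw [← valueMap_comp, comp_base, ← hi, Category.assoc]
      -- Both composites are given by `τ` at `L` and the arrow `φ ≫ v`.
      have e₁ := h e₁ L (φ ≫ v) (w := Over.mk (w.hom ≫ (valueMap H v).base)) i.hom hi₁ k
        (hk₁.trans (Category.assoc _ _ _).symm)
      have e₂ := eval_comp_app (valueMap_comp H φ v) (w := w)
        (w' := Over.mk (w.hom ≫ (valueMap H v).base)) i.hom hi (𝟙 w.left) (Category.id_comp _)
        (Category.comp_id i.hom) hi₁
      have e₃ := h e L φ i.hom hi (w' := Over.mk (w.hom ≫ baseComparison H H' e)) (𝟙 w.left)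
        (Category.id_comp _)
      have e₄ := eval_comp_app (valueMap_comp H' φ v)
        (w := Over.mk (w.hom ≫ baseComparison H H' e)) (baseComparison H' H L ≫ i.hom ≫ 𝟙 w.left)
        (lift_base_eq (H := H) (H' := H') e L φ i.hom hi
          (w' := Over.mk (w.hom ≫ baseComparison H H' e)) (𝟙 w.left) (Category.id_comp _)) k hk₂
        (m := baseComparison H' H L ≫ i.hom ≫ k) (by simp)
        (lift_base_eq _ _ (φ ≫ v) (w := Over.mk (w.hom ≫ (valueMap H v).base)) i.hom hi₁ k
          (hk₁.trans (Category.assoc _ _ _).symm))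
      have e₅ := app_comp_app (α := θ e) (β := valueMap H' v) rfl (w := w)
        (w' := Over.mk (w.hom ≫ baseComparison H H' e)) (𝟙 w.left)
        ((Category.id_comp _).trans (congrArg (w.hom ≫ ·) (hθ e).symm)) k hk₂
        (Category.id_comp k) (hk₂.trans ((Category.assoc _ _ _).trans
          (congrArg (fun g => w.hom ≫ g ≫ (valueMap H' v).base) (hθ e).symm)))
      refine (Category.assoc _ _ _).symm.trans ((congrArg (· ≫ _) e₂).trans (e₁.trans ?_))
      refine Eq.trans ?_ (congrArg (_ ≫ ·) e₅)
      refine Eq.trans ?_ (Category.assoc _ _ _)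
      refine Eq.trans ?_ (congrArg (· ≫ _) e₃.symm)
      exact (congrArg (_ ≫ ·) e₄.symm).trans (Category.assoc _ _ _).symm
    refine ⟨{ toNatTrans := { app := θ, naturality := fun _ _ v => hnat v }
              isHomLift' := fun e => ?_ }, ?_⟩
    · refine IsHomLift.of_fac' (proj p F) _ (θ e) (H.w_obj e) (H'.w_obj e) ?_
      refine (hθ e).trans ((baseComparison_eq H H' e).trans ?_)
      rw [Category.id_comp]
      exact (eqToHom_trans _ _).symm
    · refine BasedNatTrans.ext _ _ (NatTrans.ext (funext fun (e : E.obj) => ?_))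
      have h₁ := h e e (𝟙 e) (w := Over.mk (𝟙 _)) (𝟙 _)
        ((Category.id_comp _).trans (congrArg Hom.base (H.toFunctor.map_id e)).symm)
        (w' := Over.mk (𝟙 _)) (baseComparison H H' e)
        ((Category.comp_id _).trans (Category.id_comp _).symm)
      have h₂ : Hom.app (θ e) (w := Over.mk (𝟙 _)) (w' := Over.mk (𝟙 _)) (baseComparison H H' e) _ =
          transposedApp τ e :=
        (Category.id_comp _).symm.trans
          ((congrArg (· ≫ _) (eval_valueMap_id H e _ rfl _).symm).trans
            (h₁.trans ((congrArg (_ ≫ ·) (eval_valueMap_id H' e _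
              ((congrArg (_ ≫ ·) (Category.id_comp _)).trans (baseComparison_comp H' H e))
              _)).trans (Category.comp_id _))))
      refine Eq.trans ?_ h₂
      exact Hom.app_congr rfl (hθ e) _ _

end FullyFaithful

/-! ### Transposition is essentially surjective -/

section EssSurj

variable {E : FibredCategory.{v₄, u₄} A}

/-- The domain of a chosen cartesian lift, with codomain `e`, of an object of the slice over the
image of `e`. -/
noncomputable def pbObj (e : E.obj) (w : Over (E.p.obj e)) : E.obj :=
  Functor.IsPreFibered.pullbackObj (p := E.p) rfl w.hom

/-- A chosen cartesian lift, with codomain `e`, of an object of the slice over the image of `e`. -/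
noncomputable def pbMap (e : E.obj) (w : Over (E.p.obj e)) : pbObj e w ⟶ e :=
  Functor.IsPreFibered.pullbackMap (p := E.p) rfl w.hom

instance isStronglyCartesian_pbMap (e : E.obj) (w : Over (E.p.obj e)) :
    E.p.IsStronglyCartesian w.hom (pbMap e w) := by
  have : E.p.IsCartesian w.hom (pbMap e w) :=
    Functor.IsPreFibered.pullbackMap.IsCartesian (p := E.p) rfl w.hom
  infer_instance

theorem pbObj_proj (e : E.obj) (w : Over (E.p.obj e)) : E.p.obj (pbObj e w) = w.left :=
  IsHomLift.domain_eq E.p w.hom (pbMap e w)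

/-- The arrow between chosen lifts induced by a square. -/
noncomputable def pbHom {e e' : E.obj} (φ : e ⟶ e') {w : Over (E.p.obj e)}
    {w' : Over (E.p.obj e')} (k : w.left ⟶ w'.left) (hk : k ≫ w'.hom = w.hom ≫ E.p.map φ) :
    pbObj e w ⟶ pbObj e' w' :=
  Functor.IsStronglyCartesian.map E.p w'.hom (pbMap e' w') (g := k) (f' := w.hom ≫ E.p.map φ)
    hk.symm (pbMap e w ≫ φ)

instance isHomLift_pbHom {e e' : E.obj} (φ : e ⟶ e') {w : Over (E.p.obj e)}
    {w' : Over (E.p.obj e')} (k : w.left ⟶ w'.left) (hk : k ≫ w'.hom = w.hom ≫ E.p.map φ) :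
    E.p.IsHomLift k (pbHom φ k hk) :=
  Functor.IsStronglyCartesian.map_isHomLift E.p w'.hom (pbMap e' w') (g := k)
    (f' := w.hom ≫ E.p.map φ) hk.symm (pbMap e w ≫ φ)

theorem pbHom_fac {e e' : E.obj} (φ : e ⟶ e') {w : Over (E.p.obj e)}
    {w' : Over (E.p.obj e')} (k : w.left ⟶ w'.left) (hk : k ≫ w'.hom = w.hom ≫ E.p.map φ) :
    pbHom φ k hk ≫ pbMap e' w' = pbMap e w ≫ φ :=
  Functor.IsStronglyCartesian.fac E.p w'.hom (pbMap e' w') (g := k)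
    (f' := w.hom ≫ E.p.map φ) hk.symm (pbMap e w ≫ φ)

theorem pbHom_uniq {e e' : E.obj} (φ : e ⟶ e') {w : Over (E.p.obj e)}
    {w' : Over (E.p.obj e')} (k : w.left ⟶ w'.left) (hk : k ≫ w'.hom = w.hom ≫ E.p.map φ)
    (χ : pbObj e w ⟶ pbObj e' w') [E.p.IsHomLift k χ] (h : χ ≫ pbMap e' w' = pbMap e w ≫ φ) :
    χ = pbHom φ k hk :=
  Functor.IsStronglyCartesian.map_uniq E.p w'.hom (pbMap e' w') (g := k)
    (f' := w.hom ≫ E.p.map φ) hk.symm (pbMap e w ≫ φ) χ h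

theorem pbHom_id (e : E.obj) (w : Over (E.p.obj e)) (h) : pbHom (𝟙 e) (w := w) (𝟙 w.left) h = 𝟙 _ :=
  have := IsHomLift.id (pbObj_proj e w)
  (pbHom_uniq _ _ _ _ ((Category.id_comp _).trans (Category.comp_id _).symm)).symm

theorem pbHom_comp {e e' e'' : E.obj} {φ : e ⟶ e'} {ψ : e' ⟶ e''} {χ : e ⟶ e''} (hχ : φ ≫ ψ = χ)
    {w : Over (E.p.obj e)} {w' : Over (E.p.obj e')} {w'' : Over (E.p.obj e'')}
    {k : w.left ⟶ w'.left} {l : w'.left ⟶ w''.left} {m : w.left ⟶ w''.left} (hm : k ≫ l = m)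
    (hk : k ≫ w'.hom = w.hom ≫ E.p.map φ) (hl : l ≫ w''.hom = w'.hom ≫ E.p.map ψ)
    (hm' : m ≫ w''.hom = w.hom ≫ E.p.map χ) : pbHom φ k hk ≫ pbHom ψ l hl = pbHom χ m hm' := by
  subst hχ hm
  refine pbHom_uniq _ _ _ _ ?_
  rw [Category.assoc, pbHom_fac, ← Category.assoc, pbHom_fac, Category.assoc]

theorem isStronglyCartesian_pbHom {e e' : E.obj} (φ : e ⟶ e') {w : Over (E.p.obj e)}
    {w' : Over (E.p.obj e')} (k : w.left ⟶ w'.left) (hk : k ≫ w'.hom = w.hom ≫ E.p.map φ)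
    (hφ : E.p.IsStronglyCartesian (E.p.map φ) φ) :
    E.p.IsStronglyCartesian k (pbHom φ k hk) := by
  have h : E.p.IsStronglyCartesian (w.hom ≫ E.p.map φ) (pbMap e w ≫ φ) := inferInstance
  rw [← hk, ← pbHom_fac φ k hk] at h
  exact Functor.IsStronglyCartesian.of_comp (p := E.p) (g := w'.hom) (ψ := pbMap e' w')

variable {F : FibredCategory.{v₃, u₃} B} (K : FibredFunctor (oplaxSumObj p E) F)

/-- The functor underlying a fibred functor on an oplax sum, with domain the total category of the
original fibred category. -/
def sumFunctor : E.obj ⥤ F.obj := K.toFunctor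

theorem isHomLift_sumFunctor_map {a b : A} (g : a ⟶ b) {x y : E.obj} (φ : x ⟶ y)
    (h : E.p.IsHomLift g φ) : F.p.IsHomLift (p.map g) ((sumFunctor K).map φ) :=
  @BasedFunctor.preserves_isHomLift _ _ _ _ K.toBasedFunctor _ _ _ _ (p.map g) φ
    (isHomLift_comp E.p p g φ h)

theorem isStronglyCartesian_sumFunctor_map {r s : B} {a b : A} (f : r ⟶ s) (g : a ⟶ b)
    {x y : E.obj} (φ : x ⟶ y) (hg : p.IsStronglyCartesian f g) (h : E.p.IsStronglyCartesian g φ) :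
    F.p.IsStronglyCartesian f ((sumFunctor K).map φ) :=
  K.map_cartesian f φ (isStronglyCartesian_comp E.p p f g φ hg h)

theorem over_w_map_id {e : E.obj} {w w' : Over (E.p.obj e)} (m : w ⟶ w') :
    m.left ≫ w'.hom = w.hom ≫ E.p.map (𝟙 e) := by
  rw [Over.w, CategoryTheory.Functor.map_id, Category.comp_id]

/-- The restriction of `K` to the chosen cartesian lifts over `e`. -/
noncomputable def pbFunctor (e : E.obj) : Over (E.p.obj e) ⥤ F.obj where
  obj w := (sumFunctor K).obj (pbObj e w)
  map m := (sumFunctor K).map (pbHom (𝟙 e) m.left (over_w_map_id m))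
  map_id w := (congrArg (sumFunctor K).map (pbHom_id e w _)).trans ((sumFunctor K).map_id _)
  map_comp _ _ := ((sumFunctor K).map_comp _ _).symm.trans (congrArg (sumFunctor K).map
    (pbHom_comp (Category.id_comp _) rfl _ _ _)) |>.symm

/-- The value at `e` of the cotranspose of `K`, namely the restriction of `K` to the chosen
cartesian lifts over `e`. It is a fibred functor because the arrow between two chosen lifts is
cartesian over `A`. -/
noncomputable def cotransposeObj (e : E.obj) : OplaxSumRight p F where
  base := E.p.obj e
  fibred :=
    { toFunctor := pbFunctor K e
      w := CategoryTheory.Functor.ext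
        (fun w => (K.w_obj (pbObj (E := E) e w)).trans (congrArg p.obj (pbObj_proj (E := E) e w)))
        fun w w' m => @IsHomLift.fac' _ _ _ _ F.p _ _ _ _ _ _
          (isHomLift_sumFunctor_map K _ _ (isHomLift_pbHom (𝟙 e) (Over.Hom.left m)
            (over_w_map_id m)))
      map_cartesian {r s} f w w' m h := by
        have h' := (isStronglyCartesian_of_comp (Over.forget (E.p.obj e)) p f m h).1
        refine isStronglyCartesian_sumFunctor_map K f (Over.Hom.left m) _ h' ?_
        exact isStronglyCartesian_pbHom _ _ _ (Functor.IsStronglyCartesian.of_isIso E.p _ (𝟙 e)) }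

/-- The arrow between values of the cotranspose of `K` induced by an arrow of `E`. -/
noncomputable def cotransposeHom {e e' : E.obj} (φ : e ⟶ e') :
    cotransposeObj K e ⟶ cotransposeObj K e' where
  base := E.p.map φ
  app k hk := (sumFunctor K).map (pbHom φ k hk)
  isHomLift k hk := isHomLift_sumFunctor_map K _ _ (isHomLift_pbHom φ k hk)
  map_app _ _ _ := ((sumFunctor K).map_comp _ _).symm.trans (congrArg (sumFunctor K).map
    (pbHom_comp (Category.id_comp _) rfl _ _ _))
  app_map _ _ n := ((sumFunctor K).map_comp _ _).symm.trans (congrArg (sumFunctor K).map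
    (pbHom_comp (Category.comp_id _) rfl _ (over_w_map_id n) _))

/-- The fibred functor over `A` whose transpose is `K`, up to isomorphism. -/
noncomputable def cotranspose : FibredFunctor E (oplaxSumRightObj p F) where
  obj e := cotransposeObj K e
  map φ := cotransposeHom K φ
  map_id e := OplaxSumRight.hom_ext (E.p.map_id e) fun _ _ => rfl
  map_comp φ ψ := OplaxSumRight.hom_ext (E.p.map_comp φ ψ) fun {w w'} k hk => by
    refine (congrArg (sumFunctor K).map ?_).trans ((sumFunctor K).map_comp _ _)
    exact (pbHom_comp rfl (Category.id_comp k) (w' := Over.mk (w.hom ≫ E.p.map φ))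
      (Category.id_comp _) _ _).symm
  w := rfl
  map_cartesian f x y φ h := by
    obtain ⟨⟩ := h.toIsHomLift
    refine isStronglyCartesian_of_isIso_app (cotransposeHom K φ) fun w => ?_
    have hk : 𝟙 w.left ≫ (Over.mk (w.hom ≫ E.p.map φ)).hom = w.hom ≫ E.p.map φ :=
      Category.id_comp _
    have h₁ := isStronglyCartesian_pbHom φ (w := w) (w' := Over.mk (w.hom ≫ E.p.map φ))
      (𝟙 w.left) hk h
    have : IsIso (pbHom φ (w := w) (w' := Over.mk (w.hom ≫ E.p.map φ)) (𝟙 w.left) hk) :=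
      @Functor.IsStronglyCartesian.isIso_of_base_isIso _ _ _ _ E.p _ _ _ _ _ _ h₁
        (inferInstanceAs (IsIso (𝟙 w.left)))
    exact Functor.map_isIso (sumFunctor K)
      (pbHom φ (w := w) (w' := Over.mk (w.hom ≫ E.p.map φ)) (𝟙 w.left) hk)

/-- The lifts of identities compare the transpose of `cotranspose K` with `K`. -/
noncomputable def transposeCotransposeIso {E : FibredCategory.{max v₃ u₁ v₁, max u₃ v₃ u₁ v₁} A}
    (K : FibredFunctor (oplaxSumObj p E) F) :
    (oplaxSumTranspose p E F).obj (cotranspose K) ≅ K :=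
  have hlift (e : E.obj) : E.p.IsHomLift (𝟙 (E.p.obj e)) (pbMap e (Over.mk (𝟙 _))) :=
    (isStronglyCartesian_pbMap e (Over.mk (𝟙 _))).toIsHomLift
  have hiso (e : E.obj) : IsIso (pbMap e (Over.mk (𝟙 _))) :=
    @Functor.IsStronglyCartesian.isIso_of_base_isIso _ _ _ _ E.p _ _ _ _ _ _
      (isStronglyCartesian_pbMap e (Over.mk (𝟙 _))) (inferInstanceAs (IsIso (𝟙 (E.p.obj e))))
  let i : ((oplaxSumTranspose p E F).obj (cotranspose K)).toBasedFunctor ≅ K.toBasedFunctor :=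
    BasedNatIso.mkNatIso
      (NatIso.ofComponents (fun e => (sumFunctor K).mapIso
          (@asIso _ _ _ _ (pbMap (E := E) e (Over.mk (𝟙 _))) (hiso e)))
        fun φ => by
          refine ((sumFunctor K).map_comp _ _).symm.trans
            (Eq.trans ?_ ((sumFunctor K).map_comp _ _))
          exact congrArg (sumFunctor K).map (pbHom_fac _ _ _))
      fun e => p.map_id (E.p.obj e) ▸ isHomLift_sumFunctor_map K _ _ (hlift e)
  { hom := i.hom
    inv := i.inv
    hom_inv_id := i.hom_inv_id
    inv_hom_id := i.inv_hom_id }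

end EssSurj

end OplaxSumRight

instance isEquivalence_oplaxSumTranspose (E : FibredCategory.{max v₃ u₁ v₁, max u₃ v₃ u₁ v₁} A)
    (F : FibredCategory.{v₃, u₃} B) : (oplaxSumTranspose p E F).IsEquivalence where
  faithful := OplaxSumRight.faithful_oplaxSumTranspose
  full := OplaxSumRight.full_oplaxSumTranspose
  essSurj := ⟨fun K => ⟨OplaxSumRight.cotranspose K, ⟨OplaxSumRight.transposeCotransposeIso K⟩⟩⟩

/-! ### The pseudo-adjunction -/

theorem OplaxSumRight.evalFunctor_map_map₂App (p : A ⥤ B) [p.IsFibered]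
    {F F' : FibredCategory.{v₃, u₃} B} {S T : FibredFunctor F F'} (τ : S ⟶ T)
    (X : OplaxSumRight p F) :
    (evalFunctor p F').map (map₂App p τ X) = τ.toNatTrans.app X.pt :=
  (congrArg (· ≫ τ.toNatTrans.app X.pt) ((congrArg S.toFunctor.map
    ((evalFunctor p F).map_id X)).trans (S.toFunctor.map_id X.pt))).trans (Category.id_comp _)

/-- The oplax sum along `p` is left pseudo-adjoint to `oplaxSumRight p`. Since evaluation at
identities commutes strictly with postcomposition, all pseudo-naturality cells are identities. -/
def oplaxSumPseudoAdjunction (p : A ⥤ B) [p.IsFibered] :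
    PseudoAdjunction
      (oplaxSum.{max v u₁ v₁, max u v u₁ v₁} p).toPseudofunctor
      (oplaxSumRight.{v, u} p).toPseudofunctor where
  transpose E F := oplaxSumTranspose p E F
  isEquivalence E F := isEquivalence_oplaxSumTranspose E F
  cell f g h := Iso.refl _
  cell_natural f g h h' θ := FibredCategory.hom₂_ext _ _ fun _ =>
    (Category.comp_id _).trans (Category.id_comp _).symm
  cell_map₂ {X X' Y Y' f f' g g'} σ τ h := FibredCategory.hom₂_ext _ _ fun e => by
    refine (Category.comp_id _).trans (Eq.trans ?_ (Category.id_comp _).symm)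
    refine ((OplaxSumRight.evalFunctor p Y').map_comp _ _).trans (congrArg (_ ≫ ·) ?_)
    exact OplaxSumRight.evalFunctor_map_map₂App p τ (h.toFunctor.obj (f'.toFunctor.obj e))
  cell_id {X Y} h := FibredCategory.hom₂_ext _ _ fun (e : X.obj) => by
    let x : OplaxSumRight p Y := h.toFunctor.obj e
    have hx : (OplaxSumRight.evalFunctor p Y).map (𝟙 x) = 𝟙 x.pt :=
      (OplaxSumRight.evalFunctor p Y).map_id x
    have hh : (OplaxSumRight.evalFunctor p Y).map (h.toFunctor.map (𝟙 e)) = 𝟙 x.pt :=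
      (congrArg (OplaxSumRight.evalFunctor p Y).map (h.toFunctor.map_id e)).trans hx
    change 𝟙 x.pt ≫ (OplaxSumRight.evalFunctor p Y).map (h.toFunctor.map (𝟙 e)) ≫
      𝟙 x.pt ≫ 𝟙 x.pt = (OplaxSumRight.evalFunctor p Y).map (𝟙 x ≫ 𝟙 x ≫ 𝟙 x)
    refine (congrArg (fun t => 𝟙 x.pt ≫ t ≫ 𝟙 x.pt ≫ 𝟙 x.pt) hh).trans ?_
    simp only [Category.comp_id]
    exact hx.symm
  cell_comp {X X' X'' Y Y' Y''} f f' g g' h := FibredCategory.hom₂_ext _ _ fun (e : X''.obj) => by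
    let x : OplaxSumRight p Y := h.toFunctor.obj (f.toFunctor.obj (f'.toFunctor.obj e))
    let z : OplaxSumRight p Y'' :=
      (OplaxSumRight.mapFunctor p g').obj ((OplaxSumRight.mapFunctor p g).obj x)
    have hz : (OplaxSumRight.evalFunctor p Y'').map (𝟙 z) = 𝟙 z.pt :=
      (OplaxSumRight.evalFunctor p Y'').map_id z
    let T := h.toFunctor ⋙ OplaxSumRight.evalFunctor p Y ⋙ g.toFunctor ⋙ g'.toFunctor
    have hT : T.map (𝟙 (f.toFunctor.obj (f'.toFunctor.obj e))) = 𝟙 z.pt := T.map_id _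
    have hg : g'.toFunctor.map (𝟙 (g.toFunctor.obj x.pt)) = 𝟙 z.pt := g'.toFunctor.map_id _
    change 𝟙 z.pt ≫ T.map (𝟙 (f.toFunctor.obj (f'.toFunctor.obj e))) ≫
        𝟙 z.pt ≫ 𝟙 z.pt ≫ 𝟙 z.pt =
      (OplaxSumRight.evalFunctor p Y'').map (𝟙 z ≫ 𝟙 z ≫ 𝟙 z ≫ 𝟙 z) ≫
        𝟙 z.pt ≫ g'.toFunctor.map (𝟙 (g.toFunctor.obj x.pt))
    refine (congrArg (fun t => 𝟙 z.pt ≫ t ≫ 𝟙 z.pt ≫ 𝟙 z.pt ≫ 𝟙 z.pt) hT).trans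
      (Eq.trans ?_ (congrArg (fun t => _ ≫ 𝟙 z.pt ≫ t) hg).symm)
    simp only [Category.comp_id]
    exact hz.symm.trans
      ((Category.comp_id _).symm.trans (congrArg (_ ≫ ·) (Category.comp_id _).symm))

end RightAdjoint

theorem mainTheorem2 {A : Type u₁} [Category.{v₁} A] {B : Type u₂} [Category.{v₂} B]
    (p : A ⥤ B) [p.IsFibered] :
    ∃ R : FibredCategory.{max v u₁ v₁, max u v u₁ v₁} B ⥤ᵖ
        FibredCategory.{max v u₁ v₁, max u v u₁ v₁} A,
      Nonempty (PseudoAdjunction (oplaxSum p).toPseudofunctor R) :=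
  ⟨(oplaxSumRight.{v, u} p).toPseudofunctor, ⟨oplaxSumPseudoAdjunction.{v, u} p⟩⟩
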